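/- Let $g\in C^1([0,\infty))$ satisfy $g'<0$ on $[0,\infty)$ and $g(0)=0$ (umbilical constant $\alpha=0$), and let $b:=\lim_{t\to\infty}g(t)\in[-\infty,0)$. Let $\mathcal W_g$ be the elliptic Weingarten class of oriented surfaces in $\mathbb R^3$ whose principal curvatures $\kappa_1\ge\kappa_2$ satisfy $\kappa_1\ge 0$ and $\kappa_2=g(\kappa_1)$ at every point. Let $f:(b,\infty)\to(b,\infty)$ be equal to $g$ on $[0,\infty)$ and to $g^{-1}$ on $(b,0]$, and let $\mathcal G(\lambda)=\lambda\, e^{\mathcal F(\lambda)}$ on $(b,\infty)\setminus\{0\}$, where $\mathcal F$ is any primitive of $1/(f(\lambda)-\lambda)$; write $\mathcal G(\infty)$ and $\mathcal G(b)$ for its limits as $\lambda\to\infty$ and as $\lambda\to b^+$. By a rotational surface we mean a connected oriented $C^2$ surface without boundary generated by rotating around the $z$-axis a curve $(x(s),0,z(s))$ with $x\ge 0$, parametrized by arc length on an interval (and $C^2$ also at points on the axis, if there are any). The following rotational surfaces of $\mathcal W_g$ are considered. - A *special catenoid* of necksize $\tau>0$ is a complete embedded surface of $\mathcal W_g$ obtained,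 up to a vertical translation, by rotating a convex curve $(\xi(z),0,z)$, $z\in(-z_1,z_1)$, $0<z_1\le\infty$, where $\xi$ is $C^2$, positive and even, has minimum $\tau=\xi(0)$, and $\xi(z)\to\infty$ as $z\to\pm z_1$. It is denoted $C_\tau^+$ if its unit normal is the interior one (pointing towards the axis) and $C_\tau^-$ if it is the exterior one. - A *pinched special catenoid* is a surface of $\mathcal W_g$ that is a rotational $C^2$ graph $z=u(r)$ over the whole punctured plane $r>0$ with convex profile curve ($u$ is convex or concave), such that $u$ has a finite limit as $r\to0$ but the graph does not extend to a $C^2$ surface across $r=0$ (it has an isolated singularity on the axis). - A *singular special catenoid* is a surface of $\mathcal W_g$ that is a rotational $C^2$ graph $z=u(r)$ over the exterior $r>d$ of a circle, $d>0$, with convex profile curve ($u$ is convex or concave), such that $u$ has a finite limit as $r\to d$ while the second fundamental form blows up there ($\kappa_1^2+\kappa_2^2\to\infty$ as $r\to d$). **Theorem.** Every rotational surface in $\mathcal W_g$ is an open piece of one of the following surfaces: 1. a plane (orthogonal to the $z$-axis); 2. a special catenoid $C_\tau^+$ or $C_\tau^-$ for some $\tau>0$; 3. a pinched special catenoid; 4.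 a singular special catenoid. Moreover, a pinched special catenoid exists in $\mathcal W_g$ if and only if either $|\mathcal G(\infty)|<\infty$, or $b=-\infty$ and $|\mathcal G(b)|<\infty$; and a singular special catenoid exists in $\mathcal W_g$ if and only if $b\ne-\infty$ and $|\mathcal G(b)|<\infty$. -/

import Mathlib

namespace Weingarten

noncomputable section

/-- Euclidean three-space. -/
abbrev E3 : Type := EuclideanSpace ℝ (Fin 3)

/-! Principal curvatures of a parametrized oriented surface. -/

/-- First fundamental form of the parametrization `X` at `q`. -/
def firstForm (X : ℝ × ℝ → E3) (q v w : ℝ × ℝ) : ℝ :=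
  inner ℝ (fderiv ℝ X q v) (fderiv ℝ X q w)

/-- Second fundamental form of the parametrization `X` at `q`, for the unit normal `ν` at `q`. -/
def secondForm (X : ℝ × ℝ → E3) (ν : E3) (q v w : ℝ × ℝ) : ℝ :=
  inner ℝ (fderiv ℝ (fderiv ℝ X) q v w) ν

/-- Determinant `EG - F²` of the first fundamental form. -/
def areaSq (X : ℝ × ℝ → E3) (q : ℝ × ℝ) : ℝ :=
  firstForm X q (1, 0) (1, 0) * firstForm X q (0, 1) (0, 1) - firstForm X q (1, 0) (0, 1) ^ 2

/-- Mean curvature. -/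
def meanCurv (X : ℝ × ℝ → E3) (ν : E3) (q : ℝ × ℝ) : ℝ :=
  (secondForm X ν q (1, 0) (1, 0) * firstForm X q (0, 1) (0, 1)
    - 2 * secondForm X ν q (1, 0) (0, 1) * firstForm X q (1, 0) (0, 1)
    + secondForm X ν q (0, 1) (0, 1) * firstForm X q (1, 0) (1, 0)) / (2 * areaSq X q)

/-- Gauss curvature. -/
def gaussCurv (X : ℝ × ℝ → E3) (ν : E3) (q : ℝ × ℝ) : ℝ :=
  (secondForm X ν q (1, 0) (1, 0) * secondForm X ν q (0, 1) (0, 1)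
    - secondForm X ν q (1, 0) (0, 1) ^ 2) / areaSq X q

/-- The larger principal curvature `κ₁`. -/
def kappa1 (X : ℝ × ℝ → E3) (ν : E3) (q : ℝ × ℝ) : ℝ :=
  meanCurv X ν q + Real.sqrt (meanCurv X ν q ^ 2 - gaussCurv X ν q)

/-- The smaller principal curvature `κ₂`. -/
def kappa2 (X : ℝ × ℝ → E3) (ν : E3) (q : ℝ × ℝ) : ℝ :=
  meanCurv X ν q - Real.sqrt (meanCurv X ν q ^ 2 - gaussCurv X ν q)

/-! Elliptic Weingarten classes. -/

/-- An elliptic Weingarten relation `κ₂ = g(κ₁)`: `g` is `C¹` on `[α, ∞)`, `g' < 0` there, and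
`g(α) = α`. The values of `g` outside `[α, ∞)` play no role. -/
structure EllipticClass where
  α : ℝ
  g : ℝ → ℝ
  contDiffOn : ContDiffOn ℝ 1 g (Set.Ici α)
  deriv_neg : ∀ t ∈ Set.Ici α, derivWithin g (Set.Ici α) t < 0
  fixed : g α = α

/-- `b = g(∞)`, the limit of `g` at `∞` in `[-∞, ∞]` (it exists, since `g` is decreasing). -/
def EllipticClass.b (W : EllipticClass) : EReal :=
  Filter.limUnder Filter.atTop (fun t : ℝ => (W.g t : EReal))

/-- The function `f` on `(b, ∞)`: equal to `g` on `[α, ∞)` and to `g⁻¹` on `(b, α]`. -/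
def EllipticClass.f (W : EllipticClass) (t : ℝ) : ℝ :=
  open Classical in
  if W.α ≤ t then W.g t else Function.invFunOn W.g (Set.Ici W.α) t

/-- `G` is a function `𝓖(λ) = λ exp F(λ)` on `(b, ∞) \ {α}`, with `F` a primitive of
`1 / (f(λ) - λ)` there. -/
def IsGFunction (W : EllipticClass) (G : ℝ → ℝ) : Prop :=
  ∃ F : ℝ → ℝ, ∀ t : ℝ, W.b < (t : EReal) → t ≠ W.α →
    HasDerivAt F (1 / (W.f t - t)) t ∧ G t = t * Real.exp (F t)

/-- `|𝓖(Λ)| < ∞` for `Λ = ∞`: the limit of `𝓖` at `∞` is finite. -/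
def FiniteAtTop (G : ℝ → ℝ) : Prop :=
  ∃ L : ℝ, Filter.Tendsto G Filter.atTop (nhds L)

/-- `|𝓖(Λ)| < ∞` for `Λ = b`: the limit of `𝓖(t)` as the real number `t > b` tends to `b` in
`[-∞, ∞]` is finite. -/
def FiniteAtB (W : EllipticClass) (G : ℝ → ℝ) : Prop :=
  ∃ L : ℝ, Filter.Tendsto G
    (Filter.comap (fun t : ℝ => (t : EReal)) (nhdsWithin W.b (Set.Ioi W.b))) (nhds L)

/-! Rotational surfaces. -/

/-- A connected oriented rotational `C²` surface (without boundary, possibly with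
self-intersections), given by the rotation about the `z`-axis of a profile curve
`s ↦ (x(s), 0, z(s))`, `s ∈ J`, parametrized by arc length, with `x ≥ 0`, and so directed that the
unit normal along the curve is the tangent vector turned by `π/2`. Derivatives within the interval
`J` are one-sided at an endpoint. -/
structure RotSurface where
  J : Set ℝ
  x : ℝ → ℝ
  z : ℝ → ℝ
  interval : J.OrdConnected
  nontrivial : J.Nontrivial
  contDiffOn_x : ContDiffOn ℝ 2 x J
  contDiffOn_z : ContDiffOn ℝ 2 z J
  nonneg : ∀ s ∈ J, 0 ≤ x s
  arcLength : ∀ s ∈ J, derivWithin x J s ^ 2 + derivWithin z J s ^ 2 = 1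
  /-- The surface has no boundary: only points of the axis can be ends of the profile curve. -/
  mem_interior : ∀ s ∈ J, 0 < x s → s ∈ interior J
  /-- Near a point on the axis, the surface is the graph of a (radial) `C²` function on a disk. -/
  regular_on_axis : ∀ s ∈ J, x s = 0 → ∃ w : ℝ → ℝ,
    ContDiffAt ℝ 2 (fun p : EuclideanSpace ℝ (Fin 2) => w ‖p‖) 0 ∧
      ∀ᶠ t in nhdsWithin s J, z t = w (x t)

namespace RotSurface

/-- The parametrization `(s, θ) ↦ (x(s) cos θ, x(s) sin θ, z(s))`. -/
def param (S : RotSurface) (q : ℝ × ℝ) : E3 :=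
  !₂[S.x q.1 * Real.cos q.2, S.x q.1 * Real.sin q.2, S.z q.1]

/-- The unit normal `(- z'(s) cos θ, - z'(s) sin θ, x'(s))`. -/
def normal (S : RotSurface) (q : ℝ × ℝ) : E3 :=
  !₂[- derivWithin S.z S.J q.1 * Real.cos q.2, - derivWithin S.z S.J q.1 * Real.sin q.2,
    derivWithin S.x S.J q.1]

/-- The surface as a set of points. -/
def carrier (S : RotSurface) : Set E3 := S.param '' (S.J ×ˢ Set.univ)

/-- The trace `{(x(s), z(s))}` of the profile curve. -/
def trace (S : RotSurface) : Set (ℝ × ℝ) := (fun s => (S.x s, S.z s)) '' S.J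

/-- The surface belongs to the class `𝓦_g`: `κ₁ ∈ [α, ∞)` and `κ₂ = g(κ₁)`. The relation is
written at the points off the axis; at the (at most two) points on the axis it then holds too, as
the surface is `C²` and `g` is continuous. -/
def InClass (W : EllipticClass) (S : RotSurface) : Prop :=
  ∀ s ∈ S.J, 0 < S.x s → ∀ θ : ℝ,
    W.α ≤ kappa1 S.param (S.normal (s, θ)) (s, θ) ∧
    kappa2 S.param (S.normal (s, θ)) (s, θ) = W.g (kappa1 S.param (S.normal (s, θ)) (s, θ))

/-- `S` is an open piece of `T`: the profile curve of `S` is, up to a shift of the arc length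
parameter, the restriction of that of `T` to a subinterval (so the unit normals agree as well). -/
def IsOpenPiece (S T : RotSurface) : Prop :=
  ∃ c : ℝ, ∀ s ∈ S.J, s + c ∈ T.J ∧ S.x s = T.x (s + c) ∧ S.z s = T.z (s + c)

/-- `T` is a plane (orthogonal to the axis). -/
def IsPlane (T : RotSurface) : Prop :=
  ∃ c : ℝ, T.carrier = {p : E3 | p 2 = c}

/-- `T` is a complete surface of the class, whose profile is a convex curve `(ξ(h), 0, c + h)`,
`h ∈ (-z₁, z₁)`, `z₁ ∈ (0, ∞]`, with `ξ` positive, even, tending to `∞` at the ends, and with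
minimum `τ = ξ(0)`. -/
def IsSpecialCatenoid (W : EllipticClass) (τ : ℝ) (T : RotSurface) : Prop :=
  T.InClass W ∧ T.J = Set.univ ∧
  ∃ (c : ℝ) (z₁ : EReal) (ξ : ℝ → ℝ), 0 < z₁ ∧
    T.trace = (fun h => (ξ h, c + h)) '' {h : ℝ | ((|h| : ℝ) : EReal) < z₁} ∧
    ContDiffOn ℝ 2 ξ {h : ℝ | ((|h| : ℝ) : EReal) < z₁} ∧
    ConvexOn ℝ {h : ℝ | ((|h| : ℝ) : EReal) < z₁} ξ ∧
    (∀ h : ℝ, ((|h| : ℝ) : EReal) < z₁ → 0 < ξ h ∧ ξ (-h) = ξ h ∧ τ ≤ ξ h) ∧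
    ξ 0 = τ ∧
    Filter.Tendsto ξ
      (Filter.comap (fun h : ℝ => (h : EReal)) (nhdsWithin z₁ (Set.Iio z₁))) Filter.atTop

/-- `C_τ⁺`: the special catenoid of necksize `τ` with interior unit normal (that is, the radial
component `- z'` of the normal is negative). -/
def IsCatenoidPlus (W : EllipticClass) (τ : ℝ) (T : RotSurface) : Prop :=
  T.IsSpecialCatenoid W τ ∧ ∀ s ∈ T.J, 0 < derivWithin T.z T.J s

/-- `C_τ⁻`: the special catenoid of necksize `τ` with exterior unit normal. -/
def IsCatenoidMinus (W : EllipticClass) (τ : ℝ) (T : RotSurface) : Prop :=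
  T.IsSpecialCatenoid W τ ∧ ∀ s ∈ T.J, derivWithin T.z T.J s < 0

/-- Pinched special catenoid: a surface of the class that is a graph `z = u(r)` over the whole
plane minus the origin, with convex profile curve, that extends continuously to the origin and has
a singularity there, i.e. it does not extend as a `C²` surface. -/
def IsPinchedCatenoid (W : EllipticClass) (T : RotSurface) : Prop :=
  T.InClass W ∧
  ∃ u : ℝ → ℝ,
    T.trace = (fun r => (r, u r)) '' Set.Ioi 0 ∧
    ContDiffOn ℝ 2 u (Set.Ioi 0) ∧
    (ConvexOn ℝ (Set.Ioi 0) u ∨ ConcaveOn ℝ (Set.Ioi 0) u) ∧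
    ContinuousWithinAt u (Set.Ioi 0) 0 ∧
    ¬ ContDiffAt ℝ 2 (fun p : EuclideanSpace ℝ (Fin 2) => u ‖p‖) 0

/-- Singular special catenoid: a surface of the class that is a graph `z = u(r)` over the exterior
of a circle `r = d`, with convex profile curve, that extends continuously to the boundary circle,
and whose second fundamental form blows up there (`κ₁² + κ₂² → ∞`). -/
def IsSingularCatenoid (W : EllipticClass) (T : RotSurface) : Prop :=
  T.InClass W ∧
  ∃ (d : ℝ) (u : ℝ → ℝ), 0 < d ∧
    T.trace = (fun r => (r, u r)) '' Set.Ioi d ∧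
    ContDiffOn ℝ 2 u (Set.Ioi d) ∧
    (ConvexOn ℝ (Set.Ioi d) u ∨ ConcaveOn ℝ (Set.Ioi d) u) ∧
    ContinuousWithinAt u (Set.Ioi d) d ∧
    Filter.Tendsto
      (fun s => kappa1 T.param (T.normal (s, 0)) (s, 0) ^ 2
        + kappa2 T.param (T.normal (s, 0)) (s, 0) ^ 2)
      (Filter.comap T.x (nhds d) ⊓ Filter.principal T.J) Filter.atTop

end RotSurface

end

end Weingarten

/-! Let `(cos, sin)` be the direction of a profile curve and `λ = sin / x` the curvature of the
parallels. The relation between the curvatures has the first integral `x = C exp 𝓕(λ)`, that is,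
`sin = C 𝓖(λ)`, with a constant `C`. Unless `λ` vanishes identically, which gives the plane, it
never vanishes, and `λ > 0` after a reflection. There `𝓖` is increasing, so `cos` determines the
curve. If `C 𝓖` reaches the value `1`, then `cos` runs through `(-1, 1)` and the curve belongs to a
special catenoid. Otherwise `cos` keeps its sign, the curve is a graph over the radii, and `λ` runs
through its whole range: if that range is unbounded the graph reaches the axis, where `λ` blows up,
and if it is bounded the graph stops at a positive radius, where the other curvature blows up. As
`C` is arbitrary, such graphs exist if and only if `𝓖` is bounded. -/

namespace Weingarten

noncomputable section

open Set Filter Topology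

/-! ### Calculus on intervals -/

section Calculus

variable {U : Set ℝ} {f f' : ℝ → ℝ}

theorem monotoneOn_of_hasDerivAt_nonneg (hU : U.OrdConnected)
    (hf : ∀ t ∈ U, HasDerivAt f (f' t) t) (hf' : ∀ t ∈ U, 0 ≤ f' t) : MonotoneOn f U :=
  monotoneOn_of_hasDerivWithinAt_nonneg hU.convex (HasDerivAt.continuousOn hf)
    (fun t ht => (hf t (interior_subset ht)).hasDerivWithinAt)
    fun t ht => hf' t (interior_subset ht)

theorem antitoneOn_of_hasDerivAt_nonpos (hU : U.OrdConnected)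
    (hf : ∀ t ∈ U, HasDerivAt f (f' t) t) (hf' : ∀ t ∈ U, f' t ≤ 0) : AntitoneOn f U :=
  antitoneOn_of_hasDerivWithinAt_nonpos hU.convex (HasDerivAt.continuousOn hf)
    (fun t ht => (hf t (interior_subset ht)).hasDerivWithinAt)
    fun t ht => hf' t (interior_subset ht)

theorem eq_of_hasDerivWithinAt_zero (hU : U.OrdConnected)
    (hf : ∀ t ∈ U, HasDerivWithinAt f 0 U t) {a b : ℝ} (ha : a ∈ U) (hb : b ∈ U) :
    f a = f b := by
  have h : ‖f a - f b‖ ≤ 0 * ‖a - b‖ :=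
    hU.convex.norm_image_sub_le_of_norm_hasDerivWithin_le hf (fun _ _ => norm_zero.le) hb ha
  simpa [sub_eq_zero] using h

theorem eq_of_hasDerivAt_zero (hU : U.OrdConnected) (hf : ∀ t ∈ U, HasDerivAt f 0 t) {a b : ℝ}
    (ha : a ∈ U) (hb : b ∈ U) : f a = f b :=
  eq_of_hasDerivWithinAt_zero hU (fun t ht => (hf t ht).hasDerivWithinAt) ha hb

theorem hasDerivAt_integral (hU : IsOpen U) (hU' : U.OrdConnected) (hf : ContinuousOn f U)
    {a t : ℝ} (ha : a ∈ U) (ht : t ∈ U) : HasDerivAt (fun u => ∫ x in a..u, f x) (f t) t :=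
  intervalIntegral.integral_hasDerivAt_right
    (hf.mono (hU'.uIcc_subset ha ht)).intervalIntegrable
    (hf.stronglyMeasurableAtFilter hU t ht) (hf.continuousAt (hU.mem_nhds ht))

theorem contDiffOn_two_of_hasDerivAt (hU : IsOpen U) {f'' : ℝ → ℝ}
    (hf : ∀ t ∈ U, HasDerivAt f (f' t) t) (hf' : ∀ t ∈ U, HasDerivAt f' (f'' t) t)
    (hf'' : ContinuousOn f'' U) : ContDiffOn ℝ 2 f U := by
  have contDiffOn_f' : ContDiffOn ℝ 1 f' U := by
    rw [show (1 : WithTop ℕ∞) = 0 + 1 by norm_num, contDiffOn_succ_iff_deriv_of_isOpen hU,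
      contDiffOn_zero]
    exact ⟨fun t ht => (hf' t ht).differentiableAt.differentiableWithinAt, by simp,
      hf''.congr fun t ht => (hf' t ht).deriv⟩
  rw [show (2 : WithTop ℕ∞) = 1 + 1 by norm_num, contDiffOn_succ_iff_deriv_of_isOpen hU]
  exact ⟨fun t ht => (hf t ht).differentiableAt.differentiableWithinAt, by simp,
    contDiffOn_f'.congr fun t ht => (hf t ht).deriv⟩

theorem convexOn_of_hasDerivAt_of_monotoneOn (hU : U.OrdConnected)
    (hf : ∀ t ∈ U, HasDerivAt f (f' t) t) (hf' : MonotoneOn f' U) : ConvexOn ℝ U f :=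
  MonotoneOn.convexOn_of_deriv hU.convex (HasDerivAt.continuousOn hf)
    (fun t ht => (hf t (interior_subset ht)).differentiableAt.differentiableWithinAt)
    ((hf'.mono interior_subset).congr fun t ht => (hf t (interior_subset ht)).deriv.symm)

end Calculus

/-- `h` has the positive derivative `h'` on the open interval `U`, so that it is an increasing
change of variable on `U`; its inverse is `Function.invFunOn h U`. -/
structure HasPosDerivOn (h h' : ℝ → ℝ) (U : Set ℝ) : Prop where
  isOpen : IsOpen U
  ordConnected : U.OrdConnected
  hasDerivAt : ∀ t ∈ U, HasDerivAt h (h' t) t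
  pos : ∀ t ∈ U, 0 < h' t

namespace HasPosDerivOn

variable {h h' : ℝ → ℝ} {U : Set ℝ} (H : HasPosDerivOn h h' U)
include H

theorem continuousOn : ContinuousOn h U := HasDerivAt.continuousOn H.hasDerivAt

theorem strictMonoOn : StrictMonoOn h U :=
  strictMonoOn_of_hasDerivWithinAt_pos H.ordConnected.convex H.continuousOn
    (fun t ht => (H.hasDerivAt t (interior_subset ht)).hasDerivWithinAt)
    fun t ht => H.pos t (interior_subset ht)

theorem ordConnected_image : (h '' U).OrdConnected :=
  (H.ordConnected.isPreconnected.image h H.continuousOn).ordConnected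

theorem isOpen_image : IsOpen (h '' U) := by
  refine isOpen_iff_mem_nhds.2 ?_
  rintro _ ⟨t, ht, rfl⟩
  obtain ⟨a, b, hab, hU⟩ := mem_nhds_iff_exists_Ioo_subset.1 (H.isOpen.mem_nhds ht)
  obtain ⟨u, hau, hut⟩ := exists_between hab.1
  obtain ⟨v, htv, hvb⟩ := exists_between hab.2
  have hu : u ∈ U := hU ⟨hau, hut.trans hab.2⟩
  have hv : v ∈ U := hU ⟨hab.1.trans htv, hvb⟩
  exact mem_of_superset (Icc_mem_nhds (H.strictMonoOn hu ht hut) (H.strictMonoOn ht hv htv))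
    (H.ordConnected_image.out (mem_image_of_mem h hu) (mem_image_of_mem h hv))

theorem invFunOn_apply {t : ℝ} (ht : t ∈ U) : Function.invFunOn h U (h t) = t :=
  H.strictMonoOn.injOn.leftInvOn_invFunOn ht

theorem image_invFunOn : Function.invFunOn h U '' (h '' U) = U := by
  rw [image_image, image_congr fun t ht => H.invFunOn_apply ht, image_id']

theorem strictMonoOn_invFunOn : StrictMonoOn (Function.invFunOn h U) (h '' U) := by
  rintro _ ⟨t, ht, rfl⟩ _ ⟨u, hu, rfl⟩ htu
  rw [H.invFunOn_apply ht, H.invFunOn_apply hu]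
  exact (H.strictMonoOn.lt_iff_lt ht hu).1 htu

theorem hasDerivAt_invFunOn {t : ℝ} (ht : t ∈ U) :
    HasDerivAt (Function.invFunOn h U) (h' t)⁻¹ (h t) := by
  have hnhds : h '' U ∈ 𝓝 (h t) := H.isOpen_image.mem_nhds (mem_image_of_mem h ht)
  refine HasDerivAt.of_local_left_inverse (f := h) ?_ ?_ (H.pos t ht).ne' ?_
  · refine H.strictMonoOn_invFunOn.continuousAt_of_image_mem_nhds hnhds ?_
    rw [H.image_invFunOn, H.invFunOn_apply ht]
    exact H.isOpen.mem_nhds ht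
  · rw [H.invFunOn_apply ht]
    exact H.hasDerivAt t ht
  · filter_upwards [hnhds] with y hy using Function.invFunOn_eq hy

theorem hasDerivAt_comp_invFunOn {f : ℝ → ℝ} {f' t : ℝ} (ht : t ∈ U) (hf : HasDerivAt f f' t) :
    HasDerivAt (fun y => f (Function.invFunOn h U y)) (f' / h' t) (h t) :=
  HasDerivAt.comp (h t) (by rwa [H.invFunOn_apply ht]) (H.hasDerivAt_invFunOn ht)

end HasPosDerivOn

/-! ### Intervals and limits at their ends -/

theorem exists_eq_abs_lt {U : Set ℝ} (hU : IsOpen U) (hU' : U.OrdConnected) (h0 : (0 : ℝ) ∈ U)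
    (hneg : ∀ h ∈ U, -h ∈ U) :
    ∃ z₁ : EReal, 0 < z₁ ∧ U = {h : ℝ | ((|h| : ℝ) : EReal) < z₁} := by
  have abs_mem : ∀ h ∈ U, |h| ∈ U := fun h hh => by
    rcases abs_choice h with e | e <;> rw [e]
    exacts [hh, hneg h hh]
  have lt_sSup : ∀ h ∈ U, ((|h| : ℝ) : EReal) < sSup ((fun t : ℝ => (t : EReal)) '' U) := by
    intro h hh
    obtain ⟨u, hhu, hu⟩ := (hU.eventually_mem (abs_mem h hh)).exists_gt
    exact (EReal.coe_lt_coe_iff.2 hhu).trans_le (le_sSup (mem_image_of_mem _ hu))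
  refine ⟨_, by simpa using lt_sSup 0 h0, Subset.antisymm lt_sSup fun h hh => ?_⟩
  obtain ⟨_, ⟨u, hu, rfl⟩, hhu⟩ := lt_sSup_iff.1 (mem_ofPred.1 hh)
  have := abs_lt.1 (EReal.coe_lt_coe_iff.1 hhu)
  exact hU'.out (hneg u hu) hu ⟨this.1.le, this.2.le⟩

theorem eq_Ioi_csInf {U : Set ℝ} (hU : IsOpen U) (hU' : U.OrdConnected) (hb : BddBelow U)
    (hb' : ¬ BddAbove U) : U = Ioi (sInf U) := by
  refine Subset.antisymm (fun t ht => ?_) (hU'.isPreconnected.Ioi_csInf_subset hb hb')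
  obtain ⟨u, hut, hu⟩ := (hU.eventually_mem ht).exists_lt
  exact (csInf_le hb hu).trans_lt hut

/-- The open interval `(0, B)` of real numbers. -/
def posBelow (B : EReal) : Set ℝ := {t : ℝ | 0 < t ∧ (t : EReal) < B}

/-- The filter of real numbers that tend to `B` from below. -/
def atBelow (B : EReal) : Filter ℝ := comap (fun t : ℝ => (t : EReal)) (𝓝[<] B)

/-- The filter of real numbers that tend to `b` from above. -/
def atAbove (b : EReal) : Filter ℝ := comap (fun t : ℝ => (t : EReal)) (𝓝[>] b)

theorem isOpen_posBelow (B : EReal) : IsOpen (posBelow B) :=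
  isOpen_Ioi.inter (isOpen_Iio.preimage continuous_coe_real_ereal)

theorem mem_posBelow_of_le {B : EReal} {t u : ℝ} (hu : u ∈ posBelow B) (ht : 0 < t) (h : t ≤ u) :
    t ∈ posBelow B :=
  ⟨ht, (EReal.coe_le_coe_iff.2 h).trans_lt hu.2⟩

theorem ordConnected_posBelow (B : EReal) : (posBelow B).OrdConnected :=
  ⟨fun _ hx _ hy _ hz => mem_posBelow_of_le hy (hx.1.trans_le hz.1) hz.2⟩

theorem eventually_atBelow {B : EReal} {t : ℝ} (ht : (t : EReal) < B) :
    ∀ᶠ u in atBelow B, t < u ∧ (u : EReal) < B := by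
  filter_upwards [preimage_mem_comap (Ioo_mem_nhdsLT ht)] with u hu
  exact ⟨EReal.coe_lt_coe_iff.1 hu.1, hu.2⟩

theorem exists_of_eventually_atBelow {B : EReal} {t : ℝ} (ht : (t : EReal) < B) {P : ℝ → Prop}
    (h : ∀ᶠ u in atBelow B, P u) : ∃ u, t < u ∧ (u : EReal) < B ∧ P u := by
  obtain ⟨s, hs, hsP⟩ := mem_comap.1 h
  obtain ⟨l, hl, hls⟩ := (mem_nhdsLT_iff_exists_Ioo_subset' ht).1 hs
  obtain ⟨u, hu, huB⟩ := EReal.exists_between_coe_real (max_lt ht hl)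
  exact ⟨u, EReal.coe_lt_coe_iff.1 ((le_max_left _ _).trans_lt hu), huB,
    hsP (hls ⟨(le_max_right _ _).trans_lt hu, huB⟩)⟩

theorem atTop_eq_atBelow_top : (atTop : Filter ℝ) = atBelow ⊤ := by
  refine le_antisymm ?_ (atTop_basis_Ioi.ge_iff.2 fun t _ =>
    (eventually_atBelow (EReal.coe_lt_top t)).mono fun u hu => hu.1)
  rw [atBelow, ← tendsto_iff_comap]
  exact tendsto_nhdsWithin_iff.2
    ⟨EReal.tendsto_coe_atTop, Eventually.of_forall EReal.coe_lt_top⟩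

theorem tendsto_neg_atAbove (b : EReal) :
    Tendsto (fun t : ℝ => -t) (atAbove b) (atBelow (-b)) := by
  rw [atBelow, tendsto_comap_iff]
  have h : Tendsto (fun t : EReal => -t) (𝓝[>] b) (𝓝[<] (-b)) :=
    tendsto_nhdsWithin_iff.2 ⟨(continuous_neg.tendsto b).mono_left inf_le_left, by
      filter_upwards [self_mem_nhdsWithin] with t ht using EReal.neg_lt_neg_iff.2 ht⟩
  exact h.comp tendsto_comap

theorem tendsto_neg_atBelow (b : EReal) :
    Tendsto (fun t : ℝ => -t) (atBelow (-b)) (atAbove b) := by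
  rw [atAbove, tendsto_comap_iff]
  have h : Tendsto (fun t : EReal => -t) (𝓝[<] (-b)) (𝓝[>] b) :=
    tendsto_nhdsWithin_iff.2
      ⟨(continuous_neg.tendsto' (-b) b (neg_neg b)).mono_left inf_le_left, by
        filter_upwards [self_mem_nhdsWithin] with t ht using EReal.lt_neg_comm.1 ht⟩
  exact h.comp tendsto_comap

theorem exists_tendsto_atBelow_iff {B : EReal} (hB : 0 < B) {G : ℝ → ℝ}
    (hG : MonotoneOn G (posBelow B)) :
    (∃ L, Tendsto G (atBelow B) (𝓝 L)) ↔ BddAbove (G '' posBelow B) := by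
  constructor
  · rintro ⟨L, hL⟩
    refine ⟨L + 1, ?_⟩
    rintro _ ⟨t, ht, rfl⟩
    obtain ⟨u, htu, huB, hu⟩ := exists_of_eventually_atBelow ht.2
      (hL.eventually (gt_mem_nhds (lt_add_one L)))
    exact (hG ht ⟨ht.1.trans htu, huB⟩ htu.le).trans hu.le
  · intro hbdd
    obtain ⟨t₀, h1, h2⟩ := EReal.exists_between_coe_real hB
    have hne : (G '' posBelow B).Nonempty := ⟨_, mem_image_of_mem G ⟨EReal.coe_pos.1 h1, h2⟩⟩
    refine ⟨sSup (G '' posBelow B), tendsto_order.2 ⟨fun a ha => ?_, fun a ha => ?_⟩⟩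
    · obtain ⟨_, ⟨t, ht, rfl⟩, hat⟩ := exists_lt_of_lt_csSup hne ha
      filter_upwards [eventually_atBelow ht.2] with u hu
      exact hat.trans_le (hG ht ⟨ht.1.trans hu.1, hu.2⟩ hu.1.le)
    · filter_upwards [eventually_atBelow (B := B) (t := 0) (by simpa using hB)] with u hu
      exact (le_csSup hbdd (mem_image_of_mem G hu)).trans_lt ha

/-! ### The function `𝓖` of a curvature law -/

/-- A relation `k = -rate λ` between the curvature `k` of a profile curve and its rotational
principal curvature `λ ∈ (0, bound)`. An elliptic class of umbilical constant `0` gives two of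
them, one for each sign of `λ`. -/
structure CurvatureLaw where
  bound : EReal
  rate : ℝ → ℝ
  bound_pos : 0 < bound
  continuousOn_rate : ContinuousOn rate (posBelow bound)
  rate_pos : ∀ t ∈ posBelow bound, 0 < rate t
  monotoneOn_rate : MonotoneOn rate (posBelow bound)
  linear_near_zero : ∃ k K δ : ℝ, 0 < k ∧ 0 < K ∧ δ ∈ posBelow bound ∧
    ∀ t, 0 < t → t ≤ δ → k * t ≤ rate t ∧ rate t ≤ K * t
  not_bddAbove_rate : bound ≠ ⊤ → ¬ BddAbove (rate '' posBelow bound)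

/-- The function `𝓖(t) = t exp F(t)`. -/
def gFun (F : ℝ → ℝ) (t : ℝ) : ℝ := t * Real.exp (F t)

theorem gFun_pos {F : ℝ → ℝ} {t : ℝ} (ht : 0 < t) : 0 < gFun F t := mul_pos ht (Real.exp_pos _)

namespace CurvatureLaw

variable (L : CurvatureLaw)

/-- The interval of the rotational principal curvatures that the law allows. -/
abbrev domain : Set ℝ := posBelow L.bound

theorem domain_mem_nhdsGT_zero : L.domain ∈ 𝓝[>] (0 : ℝ) := by
  obtain ⟨_, _, δ, -, -, hδ, -⟩ := L.linear_near_zero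
  filter_upwards [Ioc_mem_nhdsGT hδ.1] with t ht using mem_posBelow_of_le hδ ht.1 ht.2

theorem nonempty_domain : L.domain.Nonempty := nonempty_of_mem L.domain_mem_nhdsGT_zero

theorem rate_add_pos {t : ℝ} (ht : t ∈ L.domain) : 0 < L.rate t + t :=
  add_pos (L.rate_pos t ht) ht.1

theorem le_toReal_bound (hB : L.bound ≠ ⊤) {t : ℝ} (ht : t ∈ L.domain) : t ≤ L.bound.toReal := by
  rw [← EReal.coe_le_coe_iff, EReal.coe_toReal hB (L.bound_pos.trans' EReal.bot_lt_zero).ne']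
  exact ht.2.le

theorem exists_rate_le_mul {T : ℝ} (hT : T ∈ L.domain) :
    ∃ K, 0 < K ∧ ∀ t, 0 < t → t ≤ T → L.rate t ≤ K * t := by
  obtain ⟨_, K, δ, -, hK, hδ, h⟩ := L.linear_near_zero
  refine ⟨max K (L.rate T / δ), lt_max_of_lt_left hK, fun t ht htT => ?_⟩
  rcases le_total t δ with htδ | hδt
  · exact (h t ht htδ).2.trans (mul_le_mul_of_nonneg_right (le_max_left _ _) ht.le)
  · calc L.rate t ≤ L.rate T := L.monotoneOn_rate (mem_posBelow_of_le hT ht htT) hT htT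
      _ = L.rate T / δ * δ := (div_mul_cancel₀ _ hδ.1.ne').symm
      _ ≤ L.rate T / δ * t := mul_le_mul_of_nonneg_left hδt (div_pos (L.rate_pos T hT) hδ.1).le
      _ ≤ _ := mul_le_mul_of_nonneg_right (le_max_right _ _) ht.le

/-- `F` is a primitive of `1 / (f(λ) - λ)`, where `f(λ) = -rate λ`. -/
def IsPrimitive (F : ℝ → ℝ) : Prop := ∀ t ∈ L.domain, HasDerivAt F (-(L.rate t + t)⁻¹) t

theorem exists_isPrimitive : ∃ F, L.IsPrimitive F := by
  obtain ⟨a, ha⟩ := L.nonempty_domain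
  exact ⟨_, fun t ht => hasDerivAt_integral (isOpen_posBelow _) (ordConnected_posBelow _)
    ((L.continuousOn_rate.add continuousOn_id).inv₀ fun t ht => (L.rate_add_pos ht).ne').neg ha ht⟩

namespace IsPrimitive

variable {L} {F : ℝ → ℝ} (hF : L.IsPrimitive F)
include hF

theorem antitoneOn : AntitoneOn F L.domain :=
  antitoneOn_of_hasDerivAt_nonpos (ordConnected_posBelow _) hF fun _ ht =>
    neg_nonpos.2 (inv_pos.2 (L.rate_add_pos ht)).le

theorem tendsto_nhdsGT_zero : Tendsto F (𝓝[>] 0) atTop := by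
  obtain ⟨_, K, δ, -, hK, hδ, h⟩ := L.linear_near_zero
  have sub_dom : Ioc 0 δ ⊆ L.domain := fun t ht => mem_posBelow_of_le hδ ht.1 ht.2
  have anti : AntitoneOn (fun t => F t + (K + 1)⁻¹ * Real.log t) (Ioc 0 δ) := by
    refine antitoneOn_of_hasDerivAt_nonpos ordConnected_Ioc
      (fun t ht => (hF t (sub_dom ht)).add ((Real.hasDerivAt_log ht.1.ne').const_mul _))
      fun t ht => ?_
    have : ((K + 1) * t)⁻¹ ≤ (L.rate t + t)⁻¹ :=
      inv_anti₀ (L.rate_add_pos (sub_dom ht)) (by linarith [(h t ht.1 ht.2).2])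
    rw [← mul_inv]
    linarith
  have lim : Tendsto (fun t => F δ + (K + 1)⁻¹ * Real.log δ + (K + 1)⁻¹ * (-Real.log t))
      (𝓝[>] 0) atTop :=
    tendsto_atTop_add_const_left _ _
      ((tendsto_neg_atBot_atTop.comp Real.tendsto_log_nhdsGT_zero).const_mul_atTop (by positivity))
  refine tendsto_atTop_mono' _ ?_ lim
  filter_upwards [Ioc_mem_nhdsGT hδ.1] with t ht
  linarith [anti ht (right_mem_Ioc.2 hδ.1) ht.2]

theorem tendsto_gFun_nhdsGT_zero : Tendsto (gFun F) (𝓝[>] 0) (𝓝 0) := by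
  obtain ⟨k, _, δ, hk, -, hδ, h⟩ := L.linear_near_zero
  have mono : MonotoneOn (fun t => Real.log t + F t - k / (1 + k) * Real.log t) (Ioc 0 δ) := by
    refine monotoneOn_of_hasDerivAt_nonneg ordConnected_Ioc
      (fun t ht => ((Real.hasDerivAt_log ht.1.ne').add
        (hF t (mem_posBelow_of_le hδ ht.1 ht.2))).sub
        ((Real.hasDerivAt_log ht.1.ne').const_mul _)) fun t ht => ?_
    have hle : (L.rate t + t)⁻¹ ≤ ((1 + k) * t)⁻¹ :=
      inv_anti₀ (mul_pos (by linarith) ht.1) (by linarith [(h t ht.1 ht.2).1])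
    have heq : t⁻¹ - k / (1 + k) * t⁻¹ = ((1 + k) * t)⁻¹ := by
      have := ht.1.ne'
      field_simp
      ring
    linarith
  have lim : Tendsto (fun t => Real.log δ + F δ - k / (1 + k) * Real.log δ +
      k / (1 + k) * Real.log t) (𝓝[>] 0) atBot :=
    tendsto_atBot_add_const_left _ _
      (Real.tendsto_log_nhdsGT_zero.const_mul_atBot (by positivity))
  have log_lim : Tendsto (fun t => Real.log t + F t) (𝓝[>] 0) atBot := by
    refine tendsto_atBot_mono' _ ?_ lim
    filter_upwards [Ioc_mem_nhdsGT hδ.1] with t ht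
    linarith [mono ht (right_mem_Ioc.2 hδ.1) ht.2]
  refine (Real.tendsto_exp_atBot.comp log_lim).congr' ?_
  filter_upwards [self_mem_nhdsWithin] with t ht
  rw [Function.comp, Real.exp_add, Real.exp_log ht, gFun]

theorem hasPosDerivOn_gFun :
    HasPosDerivOn (gFun F) (fun t => Real.exp (F t) * L.rate t / (L.rate t + t)) L.domain where
  isOpen := isOpen_posBelow _
  ordConnected := ordConnected_posBelow _
  hasDerivAt t ht := by
    refine ((hasDerivAt_id t).mul (hF t ht).exp).congr_deriv ?_
    have := (L.rate_add_pos ht).ne'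
    simp only [id]
    field_simp
    ring
  pos _ ht := div_pos (mul_pos (Real.exp_pos _) (L.rate_pos _ ht)) (L.rate_add_pos ht)

theorem mem_image_gFun {t v : ℝ} (ht : t ∈ L.domain) (hv : 0 < v) (hvt : v ≤ gFun F t) :
    v ∈ gFun F '' L.domain := by
  obtain ⟨u, huv, hu⟩ := ((hF.tendsto_gFun_nhdsGT_zero.eventually_lt_const hv).and
    L.domain_mem_nhdsGT_zero).exists
  exact hF.hasPosDerivOn_gFun.ordConnected_image.out (mem_image_of_mem _ hu)
    (mem_image_of_mem _ ht) ⟨huv.le, hvt⟩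

theorem bddBelow_image (hB : L.bound ≠ ⊤) : BddBelow (F '' L.domain) := by
  obtain ⟨a, ha⟩ := L.nonempty_domain
  have rate_a_pos := L.rate_pos a ha
  have mono : MonotoneOn (fun t => F t + (L.rate a)⁻¹ * t) (L.domain ∩ Ici a) := by
    refine monotoneOn_of_hasDerivAt_nonneg ((ordConnected_posBelow _).inter ordConnected_Ici)
      (fun t ht => (hF t ht.1).add ((hasDerivAt_id t).const_mul _)) fun t ht => ?_
    have : (L.rate t + t)⁻¹ ≤ (L.rate a)⁻¹ :=
      inv_anti₀ rate_a_pos (by linarith [L.monotoneOn_rate ha ht.1 ht.2, ht.1.1])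
    linarith
  refine ⟨F a - (L.rate a)⁻¹ * L.bound.toReal, ?_⟩
  rintro _ ⟨t, ht, rfl⟩
  have ht_le := mul_le_mul_of_nonneg_left (L.le_toReal_bound hB ht) (inv_pos.2 rate_a_pos).le
  rcases le_total t a with hta | hat
  · have := mul_pos (inv_pos.2 rate_a_pos) ht.1
    linarith [hF.antitoneOn ht ha hta]
  · have := mul_pos (inv_pos.2 rate_a_pos) ha.1
    have := mono ⟨ha, self_mem_Ici⟩ ⟨ht, hat⟩ hat
    simp only at this
    linarith

theorem bddAbove_image_gFun (hB : L.bound ≠ ⊤) : BddAbove (gFun F '' L.domain) := by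
  obtain ⟨a, ha⟩ := L.nonempty_domain
  have gFun_le : ∀ t ∈ L.domain, a ≤ t → gFun F t ≤ L.bound.toReal * Real.exp (F a) :=
    fun t ht hat => mul_le_mul (L.le_toReal_bound hB ht)
      (Real.exp_le_exp.2 (hF.antitoneOn ha ht hat)) (Real.exp_pos _).le
      (ht.1.le.trans (L.le_toReal_bound hB ht))
  refine ⟨L.bound.toReal * Real.exp (F a), ?_⟩
  rintro _ ⟨t, ht, rfl⟩
  rcases le_total a t with hat | hta
  · exact gFun_le t ht hat
  · exact (hF.hasPosDerivOn_gFun.strictMonoOn.monotoneOn ht ha hta).trans (gFun_le a ha le_rfl)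

end IsPrimitive

end CurvatureLaw

/-! ### Profile curves and their first integral -/

/-- The sine of the angle in `[0, π]` whose cosine is `c`. -/
def sine (c : ℝ) : ℝ := √(1 - c ^ 2)

theorem sine_pos {c : ℝ} (h : c ∈ Ioo (-1 : ℝ) 1) : 0 < sine c :=
  Real.sqrt_pos.2 (by nlinarith [h.1, h.2])

theorem sine_sq {c : ℝ} (h : c ∈ Ioo (-1 : ℝ) 1) : sine c ^ 2 = 1 - c ^ 2 :=
  Real.sq_sqrt (by nlinarith [h.1, h.2])

theorem sine_neg (c : ℝ) : sine (-c) = sine c := by simp [sine]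

theorem sine_le_one (c : ℝ) : sine c ≤ 1 :=
  Real.sqrt_le_one.2 (by linarith [sq_nonneg c])

theorem sine_sqrt {w : ℝ} (hw : 0 ≤ w) (hw1 : w ≤ 1) : sine (√(1 - w ^ 2)) = w := by
  rw [sine, Real.sq_sqrt (by nlinarith), sub_sub_cancel, Real.sqrt_sq hw]

theorem continuous_sine : Continuous sine := by
  unfold sine
  fun_prop

theorem hasDerivAt_sine {c : ℝ} (h : c ∈ Ioo (-1 : ℝ) 1) :
    HasDerivAt sine (-c / sine c) c := by
  have h1 : (1 : ℝ) - c ^ 2 ≠ 0 := by nlinarith [h.1, h.2]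
  refine (((hasDerivAt_pow 2 c).const_sub 1).sqrt h1).congr_deriv ?_
  rw [sine]
  field_simp
  norm_num

namespace CurvatureLaw

variable {L : CurvatureLaw}

variable (L) in
/-- An arc of a profile curve off the axis, parametrized by arc length on an open interval `J` and
directed upwards, whose rotational principal curvature `sine (cos s) / x s` obeys the law `L`;
`cos` is the cosine of its angle. -/
structure Profile where
  J : Set ℝ
  x : ℝ → ℝ
  z : ℝ → ℝ
  cos : ℝ → ℝ
  isOpen : IsOpen J
  ordConnected : J.OrdConnected
  nonempty : J.Nonempty
  x_pos : ∀ s ∈ J, 0 < x s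
  cos_mem : ∀ s ∈ J, cos s ∈ Ioo (-1 : ℝ) 1
  hasDerivAt_x : ∀ s ∈ J, HasDerivAt x (cos s) s
  hasDerivAt_z : ∀ s ∈ J, HasDerivAt z (sine (cos s)) s
  hasDerivAt_cos : ∀ s ∈ J, HasDerivAt cos (L.rate (sine (cos s) / x s) * sine (cos s)) s
  mem_domain : ∀ s ∈ J, sine (cos s) / x s ∈ L.domain

namespace Profile

variable (P : L.Profile) {F : ℝ → ℝ} {s : ℝ}

/-- The rotational principal curvature along a profile curve. -/
def rotCurv (s : ℝ) : ℝ := sine (P.cos s) / P.x s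

theorem x_mul_rotCurv (hs : s ∈ P.J) : P.x s * P.rotCurv s = sine (P.cos s) :=
  mul_div_cancel₀ _ (P.x_pos s hs).ne'

/-- The profile traversed backwards and reflected in a horizontal line. -/
def reverse : L.Profile where
  J := Neg.neg ⁻¹' P.J
  x s := P.x (-s)
  z s := -P.z (-s)
  cos s := -P.cos (-s)
  isOpen := P.isOpen.preimage continuous_neg
  ordConnected := ⟨fun _ ha _ hb _ ht =>
    P.ordConnected.out hb ha ⟨neg_le_neg ht.2, neg_le_neg ht.1⟩⟩
  nonempty := P.nonempty.preimage neg_surjective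
  x_pos _ hs := P.x_pos _ hs
  cos_mem _ hs := ⟨neg_lt_neg (P.cos_mem _ hs).2, neg_lt.1 (P.cos_mem _ hs).1⟩
  hasDerivAt_x s hs :=
    ((P.hasDerivAt_x _ hs).scomp s (hasDerivAt_neg s)).congr_deriv (by simp)
  hasDerivAt_z s hs :=
    ((P.hasDerivAt_z _ hs).scomp s (hasDerivAt_neg s)).neg.congr_deriv (by simp [sine_neg])
  hasDerivAt_cos s hs :=
    ((P.hasDerivAt_cos _ hs).scomp s (hasDerivAt_neg s)).neg.congr_deriv (by simp [sine_neg])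
  mem_domain s hs := by simpa [sine_neg] using P.mem_domain _ hs

theorem hasDerivAt_sine_cos (hs : s ∈ P.J) :
    HasDerivAt (fun s => sine (P.cos s)) (-(P.cos s * L.rate (P.rotCurv s))) s := by
  refine ((hasDerivAt_sine (P.cos_mem s hs)).comp s (P.hasDerivAt_cos s hs)).congr_deriv ?_
  have := (sine_pos (P.cos_mem s hs)).ne'
  rw [rotCurv]
  field_simp

theorem hasDerivAt_rotCurv (hs : s ∈ P.J) :
    HasDerivAt P.rotCurv (-(P.cos s * (L.rate (P.rotCurv s) + P.rotCurv s)) / P.x s) s := by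
  have := (P.x_pos s hs).ne'
  refine ((P.hasDerivAt_sine_cos hs).div (P.hasDerivAt_x s hs) this).congr_deriv ?_
  rw [← P.x_mul_rotCurv hs]
  field_simp
  ring

/-- `C` is the value along `P` of the first integral `x exp (-F(λ))` of the profile equation,
for a primitive `F` of the law. -/
def HasFirstIntegral (F : ℝ → ℝ) (C : ℝ) : Prop :=
  ∀ s ∈ P.J, P.x s = C * Real.exp (F (P.rotCurv s))

theorem exists_hasFirstIntegral (hF : L.IsPrimitive F) : ∃ C, 0 < C ∧ P.HasFirstIntegral F C := by
  have deriv_zero : ∀ s ∈ P.J, HasDerivAt (fun s => Real.log (P.x s) - F (P.rotCurv s)) 0 s := by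
    intro s hs
    refine (((P.hasDerivAt_x s hs).log (P.x_pos s hs).ne').sub
      ((hF _ (P.mem_domain s hs)).comp s (P.hasDerivAt_rotCurv hs))).congr_deriv ?_
    have h1 : L.rate (P.rotCurv s) + P.rotCurv s ≠ 0 := (L.rate_add_pos (P.mem_domain s hs)).ne'
    rw [← rotCurv]
    field_simp
    ring
  obtain ⟨a, ha⟩ := P.nonempty
  refine ⟨Real.exp (Real.log (P.x a) - F (P.rotCurv a)), Real.exp_pos _, fun s hs => ?_⟩
  rw [← eq_of_hasDerivAt_zero P.ordConnected deriv_zero hs ha, ← Real.exp_add, sub_add_cancel,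
    Real.exp_log (P.x_pos s hs)]

variable {P} in
theorem HasFirstIntegral.sine_cos_eq {C : ℝ} (h : P.HasFirstIntegral F C) (hs : s ∈ P.J) :
    sine (P.cos s) = C * gFun F (P.rotCurv s) := by
  rw [gFun, mul_left_comm, ← h s hs, mul_comm, P.x_mul_rotCurv hs]

/-- Up to a shift of the arc length, `P` is a restriction of `Q`. -/
def IsArcOf (P Q : L.Profile) : Prop :=
  ∃ a : ℝ, ∀ s ∈ P.J, s + a ∈ Q.J ∧ P.x s = Q.x (s + a) ∧ P.z s = Q.z (s + a)

end Profile

/-! ### The profile curve with a given first integral -/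

variable (L) in
/-- The data of an arc, parametrized by the cosine `c ∈ D` of the angle, of the profile curves with
first integral `C`. The height and the arc length are counted from the point with `c = base`. -/
structure Orbit where
  F : ℝ → ℝ
  C : ℝ
  D : Set ℝ
  base : ℝ
  isPrimitive : L.IsPrimitive F
  C_pos : 0 < C
  isOpen : IsOpen D
  ordConnected : D.OrdConnected
  base_mem : base ∈ D
  subset_Ioo : D ⊆ Ioo (-1) 1
  mem_image : ∀ c ∈ D, sine c / C ∈ gFun F '' L.domain

namespace Orbit

variable (O : L.Orbit) {c : ℝ}

/-- The rotational principal curvature, obtained from `sine c = C 𝓖(curv c)`. -/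
def curv (c : ℝ) : ℝ := Function.invFunOn (gFun O.F) L.domain (sine c / O.C)

/-- The distance to the axis. -/
def radius (c : ℝ) : ℝ := O.C * Real.exp (O.F (O.curv c))

/-- The height over the point of cosine `base`. -/
def height (c : ℝ) : ℝ := ∫ t in O.base..c, (L.rate (O.curv t))⁻¹

/-- The arc length from the point of cosine `base`. -/
def arc (c : ℝ) : ℝ := ∫ t in O.base..c, (L.rate (O.curv t) * sine t)⁻¹

theorem curv_mem (hc : c ∈ O.D) : O.curv c ∈ L.domain := Function.invFunOn_mem (O.mem_image c hc)

theorem C_mul_gFun_curv (hc : c ∈ O.D) : O.C * gFun O.F (O.curv c) = sine c := by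
  rw [curv, Function.invFunOn_eq (O.mem_image c hc), mul_div_cancel₀ _ O.C_pos.ne']

theorem sine_pos (hc : c ∈ O.D) : 0 < sine c := Weingarten.sine_pos (O.subset_Ioo hc)

theorem rate_pos (hc : c ∈ O.D) : 0 < L.rate (O.curv c) := L.rate_pos _ (O.curv_mem hc)

theorem radius_pos (c : ℝ) : 0 < O.radius c := mul_pos O.C_pos (Real.exp_pos _)

theorem sine_div_radius (hc : c ∈ O.D) : sine c / O.radius c = O.curv c := by
  rw [div_eq_iff (O.radius_pos c).ne', ← O.C_mul_gFun_curv hc, gFun, radius]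
  ring

theorem eq_curv_of_C_mul_gFun_eq {t : ℝ} (hc : c ∈ O.D) (ht : t ∈ L.domain)
    (h : sine c = O.C * gFun O.F t) : t = O.curv c :=
  O.isPrimitive.hasPosDerivOn_gFun.strictMonoOn.injOn ht (O.curv_mem hc)
    (mul_left_cancel₀ O.C_pos.ne' (h.symm.trans (O.C_mul_gFun_curv hc).symm))

theorem hasDerivAt_curv (hc : c ∈ O.D) : HasDerivAt O.curv
    (-c * (L.rate (O.curv c) + O.curv c) / (L.rate (O.curv c) * sine c * O.radius c)) c := by
  have inv := O.isPrimitive.hasPosDerivOn_gFun.hasDerivAt_invFunOn (O.curv_mem hc)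
  rw [eq_div_of_mul_eq O.C_pos.ne' ((mul_comm _ _).trans (O.C_mul_gFun_curv hc))] at inv
  refine (HasDerivAt.comp c inv ((hasDerivAt_sine (O.subset_Ioo hc)).div_const O.C)).congr_deriv ?_
  have := O.C_pos.ne'
  have := (O.sine_pos hc).ne'
  have := (O.rate_pos hc).ne'
  rw [radius]
  field_simp

theorem continuousOn_curv : ContinuousOn O.curv O.D :=
  HasDerivAt.continuousOn fun _ hc => O.hasDerivAt_curv hc

theorem continuousOn_rate_curv : ContinuousOn (fun c => L.rate (O.curv c)) O.D :=
  L.continuousOn_rate.comp O.continuousOn_curv fun _ hc => O.curv_mem hc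

theorem hasDerivAt_radius (hc : c ∈ O.D) :
    HasDerivAt O.radius (c / (L.rate (O.curv c) * sine c)) c := by
  refine (((O.isPrimitive _ (O.curv_mem hc)).comp c
    (O.hasDerivAt_curv hc)).exp.const_mul O.C).congr_deriv ?_
  have := (L.rate_add_pos (O.curv_mem hc)).ne'
  have := (O.rate_pos hc).ne'
  have := (O.sine_pos hc).ne'
  have := O.C_pos.ne'
  rw [Function.comp, radius]
  field_simp

theorem hasPosDerivOn_height :
    HasPosDerivOn O.height (fun c => (L.rate (O.curv c))⁻¹) O.D where
  isOpen := O.isOpen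
  ordConnected := O.ordConnected
  hasDerivAt _ hc := hasDerivAt_integral O.isOpen O.ordConnected
    (O.continuousOn_rate_curv.inv₀ fun _ hc => (O.rate_pos hc).ne') O.base_mem hc
  pos _ hc := inv_pos.2 (O.rate_pos hc)

theorem hasPosDerivOn_arc :
    HasPosDerivOn O.arc (fun c => (L.rate (O.curv c) * sine c)⁻¹) O.D where
  isOpen := O.isOpen
  ordConnected := O.ordConnected
  hasDerivAt _ hc := hasDerivAt_integral O.isOpen O.ordConnected
    ((O.continuousOn_rate_curv.mul continuous_sine.continuousOn).inv₀ fun _ hc =>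
      (mul_pos (O.rate_pos hc) (O.sine_pos hc)).ne') O.base_mem hc
  pos _ hc := inv_pos.2 (mul_pos (O.rate_pos hc) (O.sine_pos hc))

/-- The orbit as a profile curve, parametrized by arc length and raised by `z₀`. -/
def profile (z₀ : ℝ) : L.Profile where
  J := O.arc '' O.D
  x s := O.radius (Function.invFunOn O.arc O.D s)
  z s := z₀ + O.height (Function.invFunOn O.arc O.D s)
  cos := Function.invFunOn O.arc O.D
  isOpen := O.hasPosDerivOn_arc.isOpen_image
  ordConnected := O.hasPosDerivOn_arc.ordConnected_image
  nonempty := ⟨_, mem_image_of_mem _ O.base_mem⟩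
  x_pos s _ := O.radius_pos _
  cos_mem := forall_mem_image.2 fun c hc => by
    rw [O.hasPosDerivOn_arc.invFunOn_apply hc]
    exact O.subset_Ioo hc
  hasDerivAt_x := forall_mem_image.2 fun c hc => by
    refine (O.hasPosDerivOn_arc.hasDerivAt_comp_invFunOn hc
      (O.hasDerivAt_radius hc)).congr_deriv ?_
    have := (O.rate_pos hc).ne'
    have := (O.sine_pos hc).ne'
    rw [O.hasPosDerivOn_arc.invFunOn_apply hc]
    field_simp
  hasDerivAt_z := forall_mem_image.2 fun c hc => by
    refine ((O.hasPosDerivOn_arc.hasDerivAt_comp_invFunOn hc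
      (O.hasPosDerivOn_height.hasDerivAt c hc)).const_add z₀).congr_deriv ?_
    have := (O.rate_pos hc).ne'
    rw [O.hasPosDerivOn_arc.invFunOn_apply hc]
    field_simp
  hasDerivAt_cos := forall_mem_image.2 fun c hc => by
    rw [O.hasPosDerivOn_arc.invFunOn_apply hc, O.sine_div_radius hc]
    simpa using O.hasPosDerivOn_arc.hasDerivAt_invFunOn hc
  mem_domain := forall_mem_image.2 fun c hc => by
    rw [O.hasPosDerivOn_arc.invFunOn_apply hc, O.sine_div_radius hc]
    exact O.curv_mem hc

theorem profile_x_arc (z₀ : ℝ) (hc : c ∈ O.D) : (O.profile z₀).x (O.arc c) = O.radius c :=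
  congrArg O.radius (O.hasPosDerivOn_arc.invFunOn_apply hc)

theorem profile_z_arc (z₀ : ℝ) (hc : c ∈ O.D) : (O.profile z₀).z (O.arc c) = z₀ + O.height c :=
  congrArg (z₀ + O.height ·) (O.hasPosDerivOn_arc.invFunOn_apply hc)

theorem profile_rotCurv_arc (z₀ : ℝ) (hc : c ∈ O.D) :
    (O.profile z₀).rotCurv (O.arc c) = O.curv c := by
  rw [Profile.rotCurv, O.profile_x_arc z₀ hc, ← O.sine_div_radius hc]
  exact congrArg (sine · / _) (O.hasPosDerivOn_arc.invFunOn_apply hc)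

theorem trace_profile (z₀ : ℝ) :
    (fun s => ((O.profile z₀).x s, (O.profile z₀).z s)) '' (O.profile z₀).J =
      (fun c => (O.radius c, z₀ + O.height c)) '' O.D :=
  (image_image _ _ _).trans (image_congr fun _ hc =>
    Prod.ext (O.profile_x_arc z₀ hc) (O.profile_z_arc z₀ hc))

theorem exists_isArcOf_profile {P : L.Profile} (hP : P.HasFirstIntegral O.F O.C)
    (hD : ∀ s ∈ P.J, P.cos s ∈ O.D) : ∃ z₀, P.IsArcOf (O.profile z₀) := by
  have curv_cos : ∀ s ∈ P.J, P.rotCurv s = O.curv (P.cos s) := fun s hs =>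
    O.eq_curv_of_C_mul_gFun_eq (hD s hs) (P.mem_domain s hs) (hP.sine_cos_eq hs)
  have deriv_arc : ∀ s ∈ P.J, HasDerivAt (fun s => O.arc (P.cos s) - s) 0 s := fun s hs => by
    refine (((O.hasPosDerivOn_arc.hasDerivAt _ (hD s hs)).comp s
      (P.hasDerivAt_cos s hs)).sub (hasDerivAt_id s)).congr_deriv ?_
    rw [← Profile.rotCurv, curv_cos s hs, inv_mul_cancel₀
      (mul_pos (O.rate_pos (hD s hs)) (O.sine_pos (hD s hs))).ne', sub_self]
  have deriv_height : ∀ s ∈ P.J, HasDerivAt (fun s => O.height (P.cos s) - P.z s) 0 s :=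
    fun s hs => by
      refine (((O.hasPosDerivOn_height.hasDerivAt _ (hD s hs)).comp s
        (P.hasDerivAt_cos s hs)).sub (P.hasDerivAt_z s hs)).congr_deriv ?_
      rw [← Profile.rotCurv, curv_cos s hs, inv_mul_cancel_left₀ (O.rate_pos (hD s hs)).ne',
        sub_self]
  obtain ⟨s₀, hs₀⟩ := P.nonempty
  refine ⟨P.z s₀ - O.height (P.cos s₀), O.arc (P.cos s₀) - s₀, fun s hs => ?_⟩
  have arc_eq : s + (O.arc (P.cos s₀) - s₀) = O.arc (P.cos s) := by
    linarith [eq_of_hasDerivAt_zero P.ordConnected deriv_arc hs hs₀]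
  rw [arc_eq, O.profile_x_arc _ (hD s hs), O.profile_z_arc _ (hD s hs), radius, ← curv_cos s hs]
  refine ⟨mem_image_of_mem _ (hD s hs), hP s hs, ?_⟩
  linarith [eq_of_hasDerivAt_zero P.ordConnected deriv_height hs hs₀]

theorem tendsto_curv {e : ℝ} (he : sine e = 0) : Tendsto O.curv (𝓝[O.D] e) (𝓝[>] 0) := by
  have curv_pos : ∀ᶠ c in 𝓝[O.D] e, 0 < O.curv c := by
    filter_upwards [self_mem_nhdsWithin] with c hc using (O.curv_mem hc).1
  refine tendsto_nhdsWithin_iff.2 ⟨tendsto_order.2 ⟨fun a ha => ?_, fun a ha => ?_⟩, curv_pos⟩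
  · filter_upwards [curv_pos] with c hc using ha.trans hc
  · obtain ⟨t, hta, ht⟩ := ((eventually_nhdsWithin_of_eventually_nhds
      (eventually_lt_nhds ha)).and L.domain_mem_nhdsGT_zero).exists
    have sine_lt : ∀ᶠ c in 𝓝[O.D] e, sine c < O.C * gFun O.F t :=
      (continuous_sine.continuousWithinAt.tendsto).eventually_lt_const
        (by rw [he]; exact mul_pos O.C_pos (gFun_pos ht.1))
    filter_upwards [sine_lt, self_mem_nhdsWithin] with c hct hc
    rw [← O.C_mul_gFun_curv hc, mul_lt_mul_iff_right₀ O.C_pos,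
      O.isPrimitive.hasPosDerivOn_gFun.strictMonoOn.lt_iff_lt (O.curv_mem hc) ht] at hct
    exact hct.trans hta

theorem tendsto_radius {e : ℝ} (he : sine e = 0) : Tendsto O.radius (𝓝[O.D] e) atTop :=
  (Real.tendsto_exp_atTop.comp
    (O.isPrimitive.tendsto_nhdsGT_zero.comp (O.tendsto_curv he))).const_mul_atTop O.C_pos

end Orbit

end CurvatureLaw

/-! ### Special catenoids -/

/-- `A` is the trace of a convex profile curve of a special catenoid of necksize `τ`. -/
def IsCatenoidTrace (τ : ℝ) (A : Set (ℝ × ℝ)) : Prop :=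
  ∃ (c : ℝ) (z₁ : EReal) (ξ : ℝ → ℝ), 0 < z₁ ∧
    A = (fun h => (ξ h, c + h)) '' {h : ℝ | ((|h| : ℝ) : EReal) < z₁} ∧
    ContDiffOn ℝ 2 ξ {h : ℝ | ((|h| : ℝ) : EReal) < z₁} ∧
    ConvexOn ℝ {h : ℝ | ((|h| : ℝ) : EReal) < z₁} ξ ∧
    (∀ h : ℝ, ((|h| : ℝ) : EReal) < z₁ → 0 < ξ h ∧ ξ (-h) = ξ h ∧ τ ≤ ξ h) ∧
    ξ 0 = τ ∧ Tendsto ξ (atBelow z₁) atTop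

theorem IsCatenoidTrace.reflect {τ : ℝ} {A : Set (ℝ × ℝ)} (h : IsCatenoidTrace τ A) :
    IsCatenoidTrace τ ((fun q => (q.1, -q.2)) '' A) := by
  obtain ⟨c, z₁, ξ, hz₁, rfl, contDiff, convex, even, zero, lim⟩ := h
  refine ⟨-c, z₁, ξ, hz₁, ?_, contDiff, convex, even, zero, lim⟩
  rw [image_image]
  ext q
  constructor
  all_goals
    rintro ⟨h, hh, rfl⟩
    refine ⟨-h, by simpa using hh, Prod.ext (even h hh).2.1 ?_⟩
    simp only
    ring

theorem hasDerivAt_cot {c : ℝ} (h : c ∈ Ioo (-1 : ℝ) 1) :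
    HasDerivAt (fun c => c / sine c) (1 / sine c ^ 3) c := by
  have := (sine_pos h).ne'
  refine ((hasDerivAt_id c).div (hasDerivAt_sine h) this).congr_deriv ?_
  simp only [id]
  field_simp
  linarith [sine_sq h]

theorem monotoneOn_cot : MonotoneOn (fun c => c / sine c) (Ioo (-1) 1) :=
  monotoneOn_of_hasDerivAt_nonneg ordConnected_Ioo (fun _ hc => hasDerivAt_cot hc)
    fun c hc => by have := sine_pos hc; positivity

theorem apply_neg_of_hasDerivAt_even {U : Set ℝ} {f f' : ℝ → ℝ} (hU : U.OrdConnected)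
    (h0 : (0 : ℝ) ∈ U) (hneg : ∀ c ∈ U, -c ∈ U) (hf : ∀ c ∈ U, HasDerivAt f (f' c) c)
    (hf' : ∀ c ∈ U, f' (-c) = f' c) (hf0 : f 0 = 0) {c : ℝ} (hc : c ∈ U) : f (-c) = -f c := by
  have deriv_zero : ∀ c ∈ U, HasDerivAt (fun c => f c + f (-c)) 0 c := fun c hc =>
    ((hf c hc).add ((hf _ (hneg c hc)).scomp c (hasDerivAt_neg c))).congr_deriv (by simp [hf' c hc])
  have := eq_of_hasDerivAt_zero hU deriv_zero hc h0
  simp only [neg_zero, hf0] at this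
  linarith

namespace CurvatureLaw.Orbit

variable {L : CurvatureLaw} (O : L.Orbit) {c y : ℝ}

theorem curv_neg (hc : c ∈ O.D) (hc' : -c ∈ O.D) : O.curv (-c) = O.curv c :=
  O.eq_curv_of_C_mul_gFun_eq hc (O.curv_mem hc') (by rw [O.C_mul_gFun_curv hc', sine_neg])

theorem monotoneOn_arc_sub_radius : MonotoneOn (fun c => O.arc c - O.radius c) O.D :=
  monotoneOn_of_hasDerivAt_nonneg O.ordConnected
    (fun c hc => (O.hasPosDerivOn_arc.hasDerivAt c hc).sub (O.hasDerivAt_radius hc))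
    fun c hc => by
      rw [div_eq_mul_inv, ← one_sub_mul]
      exact mul_nonneg (sub_nonneg.2 (O.subset_Ioo hc).2.le) (O.hasPosDerivOn_arc.pos c hc).le

/-- The distance to the axis as a function of the height. -/
def radiusAt (y : ℝ) : ℝ := O.radius (Function.invFunOn O.height O.D y)

theorem radiusAt_height (hc : c ∈ O.D) : O.radiusAt (O.height c) = O.radius c :=
  congrArg O.radius (O.hasPosDerivOn_height.invFunOn_apply hc)

theorem hasDerivAt_radiusAt (hy : y ∈ O.height '' O.D) :
    HasDerivAt O.radiusAt (Function.invFunOn O.height O.D y /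
      sine (Function.invFunOn O.height O.D y)) y := by
  obtain ⟨c, hc, rfl⟩ := hy
  refine (O.hasPosDerivOn_height.hasDerivAt_comp_invFunOn hc
    (O.hasDerivAt_radius hc)).congr_deriv ?_
  have := (O.rate_pos hc).ne'
  rw [O.hasPosDerivOn_height.invFunOn_apply hc]
  field_simp

theorem contDiffOn_radiusAt : ContDiffOn ℝ 2 O.radiusAt (O.height '' O.D) := by
  refine contDiffOn_two_of_hasDerivAt O.hasPosDerivOn_height.isOpen_image
    (f'' := (fun c => L.rate (O.curv c) / sine c ^ 3) ∘ Function.invFunOn O.height O.D)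
    (fun _ => O.hasDerivAt_radiusAt) (forall_mem_image.2 fun c hc => ?_) ?_
  · refine (O.hasPosDerivOn_height.hasDerivAt_comp_invFunOn hc
      (hasDerivAt_cot (O.subset_Ioo hc))).congr_deriv ?_
    rw [Function.comp, O.hasPosDerivOn_height.invFunOn_apply hc, div_inv_eq_mul, one_div_mul_eq_div]
  · refine (O.continuousOn_rate_curv.div (continuous_sine.pow 3).continuousOn fun c hc =>
      (pow_pos (O.sine_pos hc) 3).ne').comp (forall_mem_image.2 fun c hc => ?_)
      (forall_mem_image.2 fun c hc => ?_)
    · exact (O.hasPosDerivOn_height.hasDerivAt_invFunOn hc).continuousAt.continuousWithinAt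
    · rwa [O.hasPosDerivOn_height.invFunOn_apply hc]

theorem convexOn_radiusAt : ConvexOn ℝ (O.height '' O.D) O.radiusAt := by
  refine convexOn_of_hasDerivAt_of_monotoneOn O.hasPosDerivOn_height.ordConnected_image
    (fun _ => O.hasDerivAt_radiusAt) (monotoneOn_cot.comp
      O.hasPosDerivOn_height.strictMonoOn_invFunOn.monotoneOn (forall_mem_image.2 fun c hc => ?_))
  rw [O.hasPosDerivOn_height.invFunOn_apply hc]
  exact O.subset_Ioo hc

/-- The orbit runs through all angles, starting from its vertical direction. -/
structure IsCatenoid : Prop where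
  D_eq : O.D = Ioo (-1) 1
  base_eq : O.base = 0

namespace IsCatenoid

variable {O} (h : O.IsCatenoid)
include h

theorem zero_mem : (0 : ℝ) ∈ O.D := h.base_eq ▸ O.base_mem

theorem neg_mem (c : ℝ) (hc : c ∈ O.D) : -c ∈ O.D := by
  rw [h.D_eq] at *
  exact ⟨neg_lt_neg hc.2, neg_lt.1 hc.1⟩

theorem radius_neg (hc : c ∈ O.D) : O.radius (-c) = O.radius c := by
  rw [radius, radius, O.curv_neg hc (h.neg_mem c hc)]

theorem height_zero : O.height 0 = 0 := by rw [height, h.base_eq, intervalIntegral.integral_same]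

theorem arc_zero : O.arc 0 = 0 := by rw [arc, h.base_eq, intervalIntegral.integral_same]

theorem height_neg (hc : c ∈ O.D) : O.height (-c) = -O.height c :=
  apply_neg_of_hasDerivAt_even O.ordConnected h.zero_mem h.neg_mem
    O.hasPosDerivOn_height.hasDerivAt
    (fun c hc => by rw [O.curv_neg hc (h.neg_mem c hc)]) h.height_zero hc

theorem arc_neg (hc : c ∈ O.D) : O.arc (-c) = -O.arc c :=
  apply_neg_of_hasDerivAt_even O.ordConnected h.zero_mem h.neg_mem O.hasPosDerivOn_arc.hasDerivAt
    (fun c hc => by rw [O.curv_neg hc (h.neg_mem c hc), sine_neg]) h.arc_zero hc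

theorem exists_forall_le_radius (M : ℝ) : ∃ a ∈ O.D, 0 ≤ a ∧ ∀ c ∈ O.D, a ≤ c → M ≤ O.radius c := by
  have lim := O.tendsto_radius (e := 1) (by norm_num [sine])
  rw [h.D_eq, nhdsWithin_Ioo_eq_nhdsLT (by norm_num)] at lim
  obtain ⟨a, ha, hM⟩ := (mem_nhdsLT_iff_exists_mem_Ico_Ioo_subset (zero_lt_one' ℝ)).1
    (lim.eventually_ge_atTop M)
  obtain ⟨a', haa', ha'⟩ := exists_between ha.2
  rw [h.D_eq]
  exact ⟨a', ⟨by linarith [ha.1], ha'⟩, ha.1.trans haa'.le,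
    fun c hc hac => hM ⟨haa'.trans_le hac, hc.2⟩⟩

theorem image_arc : O.arc '' O.D = univ := by
  refine eq_univ_of_forall fun y => ?_
  obtain ⟨a, ha, ha0, hM⟩ := h.exists_forall_le_radius (|y| + O.radius 0)
  have := O.monotoneOn_arc_sub_radius h.zero_mem ha ha0
  simp only [h.arc_zero] at this
  refine O.hasPosDerivOn_arc.ordConnected_image.out (mem_image_of_mem _ (h.neg_mem a ha))
    (mem_image_of_mem _ ha) ?_
  rw [h.arc_neg ha]
  exact abs_le.1 (by linarith [hM a ha le_rfl])

theorem radiusAt_zero : O.radiusAt 0 = O.radius 0 := by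
  rw [← h.height_zero, O.radiusAt_height h.zero_mem, h.height_zero]

theorem neg_mem_image_height (hy : y ∈ O.height '' O.D) :
    -y ∈ O.height '' O.D ∧ O.radiusAt (-y) = O.radiusAt y := by
  obtain ⟨c, hc, rfl⟩ := hy
  rw [← h.height_neg hc, O.radiusAt_height hc, O.radiusAt_height (h.neg_mem c hc)]
  exact ⟨mem_image_of_mem _ (h.neg_mem c hc), h.radius_neg hc⟩

theorem radius_zero_le_radiusAt (hy : y ∈ O.height '' O.D) : O.radius 0 ≤ O.radiusAt y := by
  obtain ⟨hy', even⟩ := h.neg_mem_image_height hy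
  have midpoint := O.convexOn_radiusAt.2 hy hy' one_half_pos.le one_half_pos.le
    (add_halves 1)
  simp only [smul_eq_mul, mul_neg, add_neg_cancel, even, h.radiusAt_zero] at midpoint
  linarith

theorem tendsto_radiusAt {z₁ : EReal} (hz₁ : O.height '' O.D = {y : ℝ | ((|y| : ℝ) : EReal) < z₁}) :
    Tendsto O.radiusAt (atBelow z₁) atTop := by
  refine tendsto_atTop.2 fun M => ?_
  obtain ⟨a, ha, ha0, hM⟩ := h.exists_forall_le_radius M
  have height_nonneg : 0 ≤ O.height a := by
    rw [← h.height_zero]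
    exact O.hasPosDerivOn_height.strictMonoOn.monotoneOn h.zero_mem ha ha0
  have height_lt : ((|O.height a| : ℝ) : EReal) < z₁ :=
    hz₁.subset (mem_image_of_mem _ ha)
  rw [abs_of_nonneg height_nonneg] at height_lt
  filter_upwards [eventually_atBelow height_lt] with y hy
  obtain ⟨c, hc, rfl⟩ : y ∈ O.height '' O.D := by
    rw [hz₁, mem_ofPred, abs_of_nonneg (height_nonneg.trans hy.1.le)]
    exact hy.2
  rw [O.radiusAt_height hc]
  exact hM c hc ((O.hasPosDerivOn_height.strictMonoOn.lt_iff_lt ha hc).1 hy.1).le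

theorem isCatenoidTrace (z₀ : ℝ) :
    IsCatenoidTrace (O.radius 0) ((fun c => (O.radius c, z₀ + O.height c)) '' O.D) := by
  obtain ⟨z₁, hz₁, hU⟩ := exists_eq_abs_lt O.hasPosDerivOn_height.isOpen_image
    O.hasPosDerivOn_height.ordConnected_image ⟨0, h.zero_mem, h.height_zero⟩
    fun y hy => (h.neg_mem_image_height hy).1
  refine ⟨z₀, z₁, O.radiusAt, hz₁, ?_, hU ▸ O.contDiffOn_radiusAt, hU ▸ O.convexOn_radiusAt,
    fun y hy => ?_, h.radiusAt_zero, h.tendsto_radiusAt hU⟩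
  · rw [← hU, image_image]
    exact image_congr fun c hc => by rw [O.radiusAt_height hc]
  · have hy : y ∈ O.height '' O.D := hU ▸ hy
    exact ⟨O.radius_pos _, (h.neg_mem_image_height hy).2, h.radius_zero_le_radiusAt hy⟩

end IsCatenoid

end CurvatureLaw.Orbit

theorem CurvatureLaw.IsPrimitive.exists_isCatenoid {L : CurvatureLaw} {F : ℝ → ℝ}
    (hF : L.IsPrimitive F) {C t : ℝ} (hC : 0 < C) (ht : t ∈ L.domain) (hCt : C * gFun F t = 1) :
    ∃ O : L.Orbit, O.F = F ∧ O.C = C ∧ O.IsCatenoid := by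
  have mem_image : ∀ c ∈ Ioo (-1 : ℝ) 1, sine c / C ∈ gFun F '' L.domain := fun c hc =>
    hF.mem_image_gFun ht (div_pos (sine_pos hc) hC) (by
      rw [div_le_iff₀ hC, mul_comm, hCt]
      exact sine_le_one c)
  exact ⟨⟨F, C, Ioo (-1) 1, 0, hF, hC, isOpen_Ioo, ordConnected_Ioo, by norm_num, Subset.rfl,
    mem_image⟩, rfl, rfl, rfl, rfl⟩

/-! ### Pinched and singular special catenoids -/

/-- `A` is the trace of the graph over `(d, ∞)` of a convex or concave function that extends
continuously, but not with zero derivative, to `d`. -/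
def IsGraphTrace (d : ℝ) (A : Set (ℝ × ℝ)) : Prop :=
  ∃ u : ℝ → ℝ, A = (fun r => (r, u r)) '' Ioi d ∧ ContDiffOn ℝ 2 u (Ioi d) ∧
    (ConvexOn ℝ (Ioi d) u ∨ ConcaveOn ℝ (Ioi d) u) ∧ ContinuousWithinAt u (Ioi d) d ∧
    ∃ m > 0, ∀ r, d < r → r < d + 1 → m * (r - d) ≤ |u r - u d|

theorem IsGraphTrace.reflect {d : ℝ} {A : Set (ℝ × ℝ)} (h : IsGraphTrace d A) :
    IsGraphTrace d ((fun q => (q.1, -q.2)) '' A) := by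
  obtain ⟨u, rfl, contDiff, convex, cont, m, hm, slope⟩ := h
  refine ⟨fun r => -u r, by rw [image_image], contDiff.neg, ?_, cont.neg, m, hm, fun r hr hr' => ?_⟩
  · exact convex.symm.imp (fun h => neg_convexOn_iff.2 h) (fun h => neg_concaveOn_iff.2 h)
  · rw [neg_sub_neg, abs_sub_comm]
    exact slope r hr hr'

theorem isGraphTrace_of_antitoneOn_deriv {d : ℝ} {v v' : ℝ → ℝ}
    (contDiff : ContDiffOn ℝ 2 v (Ioi d)) (deriv : ∀ r ∈ Ioi d, HasDerivAt v (v' r) r)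
    (pos : ∀ r ∈ Ioi d, 0 < v' r) (anti : AntitoneOn v' (Ioi d))
    (bdd : BddBelow (v '' Ioi d)) :
    IsGraphTrace d ((fun r => (r, v r)) '' Ioi d) := by
  have lim : Tendsto v (𝓝[>] d) (𝓝 (sInf (v '' Ioi d))) :=
    (monotoneOn_of_hasDerivAt_nonneg ordConnected_Ioi deriv fun r hr =>
      (pos r hr).le).tendsto_nhdsGT bdd
  have concave : ConcaveOn ℝ (Ioi d) v := neg_convexOn_iff.1 <|
    convexOn_of_hasDerivAt_of_monotoneOn ordConnected_Ioi (fun r hr => (deriv r hr).neg) anti.neg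
  have one_mem : d + 1 ∈ Ioi d := lt_add_one d
  have slope_mono : MonotoneOn (fun r => v r - v' (d + 1) * r) (Ioo d (d + 1)) :=
    monotoneOn_of_hasDerivAt_nonneg ordConnected_Ioo
      (fun r hr => (deriv r hr.1).sub ((hasDerivAt_id r).const_mul _)) fun r hr => by
        linarith [anti hr.1 one_mem hr.2.le]
  have slope_lim : Tendsto (fun r => v r - v' (d + 1) * r) (𝓝[>] d)
      (𝓝 (sInf (v '' Ioi d) - v' (d + 1) * d)) :=
    lim.sub ((continuous_const.mul continuous_id).continuousWithinAt.tendsto)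
  have update_eq : ∀ r ∈ Ioi d, Function.update v d (sInf (v '' Ioi d)) r = v r := fun r hr =>
    Function.update_of_ne (ne_of_gt hr) _ _
  refine ⟨Function.update v d (sInf (v '' Ioi d)), image_congr fun r hr => by rw [update_eq r hr],
    contDiff.congr update_eq, Or.inr (concave.congr fun r hr => (update_eq r hr).symm), ?_,
    v' (d + 1), pos _ one_mem, fun r hr hr1 => ?_⟩
  · rw [ContinuousWithinAt, Function.update_self]
    exact lim.congr' (by filter_upwards [self_mem_nhdsWithin] with r hr using (update_eq r hr).symm)
  · have := le_of_tendsto slope_lim (b := v r - v' (d + 1) * r) (by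
      filter_upwards [Ioo_mem_nhdsGT hr] with y hy
      exact slope_mono ⟨hy.1, hy.2.trans hr1⟩ ⟨hr, hr1⟩ hy.2.le)
    rw [update_eq r hr, Function.update_self]
    exact le_trans (by linarith) (le_abs_self _)

theorem sine_le_sine {a c : ℝ} (ha : 0 ≤ a) (hac : a ≤ c) : sine c ≤ sine a :=
  Real.sqrt_le_sqrt (by nlinarith)

theorem hasDerivAt_tan {c : ℝ} (h : c ∈ Ioo (0 : ℝ) 1) :
    HasDerivAt (fun c => sine c / c) (-1 / (sine c * c ^ 2)) c := by
  have h' : c ∈ Ioo (-1 : ℝ) 1 := ⟨by linarith [h.1], h.2⟩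
  have := (sine_pos h').ne'
  have := h.1.ne'
  refine ((hasDerivAt_sine h').div (hasDerivAt_id c) this).congr_deriv ?_
  simp only [id]
  field_simp
  linarith [sine_sq h']

theorem antitoneOn_tan : AntitoneOn (fun c => sine c / c) (Ioo 0 1) :=
  fun _ ha _ _ hab => div_le_div₀ (Real.sqrt_nonneg _) (sine_le_sine ha.1.le hab) ha.1 hab

namespace CurvatureLaw.Orbit

variable {L : CurvatureLaw} (O : L.Orbit) {c r : ℝ}

/-- The height as a function of the distance to the axis, along an arc that leaves the axis. -/
def heightAt (r : ℝ) : ℝ := O.height (Function.invFunOn O.radius O.D r)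

section

variable {O} (hD : O.D ⊆ Ioo 0 1)
include hD

theorem antitoneOn_curv : AntitoneOn O.curv O.D := fun a ha b hb hab => by
  rw [← O.isPrimitive.hasPosDerivOn_gFun.strictMonoOn.le_iff_le (O.curv_mem hb) (O.curv_mem ha),
    ← mul_le_mul_iff_right₀ O.C_pos, O.C_mul_gFun_curv ha, O.C_mul_gFun_curv hb]
  exact sine_le_sine (hD ha).1.le hab

theorem bddBelow_height : BddBelow (O.height '' O.D) := by
  have rate_pos := O.rate_pos O.base_mem
  have anti : AntitoneOn (fun c => O.height c - (L.rate (O.curv O.base))⁻¹ * c)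
      (O.D ∩ Iic O.base) := by
    refine antitoneOn_of_hasDerivAt_nonpos (O.ordConnected.inter ordConnected_Iic)
      (fun c hc => (O.hasPosDerivOn_height.hasDerivAt c hc.1).sub
        ((hasDerivAt_id c).const_mul _)) fun c hc => ?_
    linarith [inv_anti₀ rate_pos (L.monotoneOn_rate (O.curv_mem O.base_mem) (O.curv_mem hc.1)
      (antitoneOn_curv hD hc.1 O.base_mem hc.2))]
  refine ⟨O.height O.base - (L.rate (O.curv O.base))⁻¹, forall_mem_image.2 fun c hc => ?_⟩
  have := inv_pos.2 rate_pos
  rcases le_total c O.base with hcb | hbc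
  · have := anti ⟨hc, hcb⟩ ⟨O.base_mem, self_mem_Iic⟩ hcb
    simp only at this
    nlinarith [(hD hc).1, (hD O.base_mem).2]
  · linarith [O.hasPosDerivOn_height.strictMonoOn.monotoneOn O.base_mem hc hbc]

theorem hasPosDerivOn_radius :
    HasPosDerivOn O.radius (fun c => c / (L.rate (O.curv c) * sine c)) O.D where
  isOpen := O.isOpen
  ordConnected := O.ordConnected
  hasDerivAt _ hc := O.hasDerivAt_radius hc
  pos _ hc := div_pos (hD hc).1 (mul_pos (O.rate_pos hc) (O.sine_pos hc))

theorem hasDerivAt_heightAt (hr : r ∈ O.radius '' O.D) :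
    HasDerivAt O.heightAt (sine (Function.invFunOn O.radius O.D r) /
      Function.invFunOn O.radius O.D r) r := by
  obtain ⟨c, hc, rfl⟩ := hr
  refine ((hasPosDerivOn_radius hD).hasDerivAt_comp_invFunOn hc
    (O.hasPosDerivOn_height.hasDerivAt c hc)).congr_deriv ?_
  have := (O.rate_pos hc).ne'
  have := (O.sine_pos hc).ne'
  have := (hD hc).1.ne'
  rw [(hasPosDerivOn_radius hD).invFunOn_apply hc]
  field_simp

theorem contDiffOn_heightAt : ContDiffOn ℝ 2 O.heightAt (O.radius '' O.D) := by
  refine contDiffOn_two_of_hasDerivAt (hasPosDerivOn_radius hD).isOpen_image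
    (f'' := (fun c => -L.rate (O.curv c) / c ^ 3) ∘ Function.invFunOn O.radius O.D)
    (fun _ => hasDerivAt_heightAt hD) (forall_mem_image.2 fun c hc => ?_) ?_
  · refine ((hasPosDerivOn_radius hD).hasDerivAt_comp_invFunOn hc
      (hasDerivAt_tan (hD hc))).congr_deriv ?_
    have := (O.sine_pos hc).ne'
    have := (hD hc).1.ne'
    rw [Function.comp, (hasPosDerivOn_radius hD).invFunOn_apply hc]
    field_simp
  · refine (O.continuousOn_rate_curv.neg.div (continuousOn_pow 3) fun c hc =>
      (pow_pos (hD hc).1 3).ne').comp (forall_mem_image.2 fun c hc => ?_)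
      (forall_mem_image.2 fun c hc => ?_)
    · exact ((hasPosDerivOn_radius hD).hasDerivAt_invFunOn hc).continuousAt.continuousWithinAt
    · rwa [(hasPosDerivOn_radius hD).invFunOn_apply hc]

theorem isGraphTrace_of_image_radius_eq {d : ℝ} (hd : O.radius '' O.D = Ioi d) (z₀ : ℝ) :
    IsGraphTrace d ((fun c => (O.radius c, z₀ + O.height c)) '' O.D) := by
  have H := hasPosDerivOn_radius hD
  have inv_mem : ∀ r ∈ O.radius '' O.D, Function.invFunOn O.radius O.D r ∈ O.D := fun r hr =>
    Function.invFunOn_mem hr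
  have slope_anti := antitoneOn_tan.comp_MonotoneOn H.strictMonoOn_invFunOn.monotoneOn
    fun r hr => hD (inv_mem r hr)
  have trace_eq : (fun c => (O.radius c, z₀ + O.height c)) '' O.D =
      (fun r => (r, z₀ + O.heightAt r)) '' (O.radius '' O.D) := by
    rw [image_image]
    exact image_congr fun c hc => by rw [heightAt, H.invFunOn_apply hc]
  obtain ⟨m, hm⟩ := bddBelow_height hD
  rw [trace_eq, hd]
  refine isGraphTrace_of_antitoneOn_deriv (hd ▸ contDiffOn_const.add (contDiffOn_heightAt hD))
    (fun r hr => (hasDerivAt_heightAt hD (hd ▸ hr)).const_add z₀)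
    (fun r hr => div_pos (O.sine_pos (inv_mem r (hd ▸ hr))) (hD (inv_mem r (hd ▸ hr))).1)
    (hd ▸ slope_anti) ⟨z₀ + m, forall_mem_image.2 fun r hr => ?_⟩
  exact add_le_add_right (hm (mem_image_of_mem _ (inv_mem r (hd ▸ hr)))) z₀

end

/-- The orbit runs through all curvatures allowed by the law without becoming vertical. -/
structure IsGraph : Prop where
  D_eq : O.D = {c | c ∈ Ioo (0 : ℝ) 1 ∧ sine c / O.C ∈ gFun O.F '' L.domain}
  C_mul_gFun_lt_one : ∀ t ∈ L.domain, O.C * gFun O.F t < 1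

end CurvatureLaw.Orbit

section

variable {L : CurvatureLaw} {F : ℝ → ℝ} {C : ℝ}

theorem exists_sine_eq_mul_gFun (hC : 0 < C) (hlt : ∀ t ∈ L.domain, C * gFun F t < 1) {t : ℝ}
    (ht : t ∈ L.domain) :
    ∃ c ∈ {c | c ∈ Ioo (0 : ℝ) 1 ∧ sine c / C ∈ gFun F '' L.domain}, sine c = C * gFun F t := by
  have pos : 0 < C * gFun F t := mul_pos hC (gFun_pos ht.1)
  have sine_eq := sine_sqrt pos.le (hlt t ht).le
  refine ⟨√(1 - (C * gFun F t) ^ 2), ⟨⟨?_, ?_⟩, ?_⟩, sine_eq⟩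
  · exact Real.sqrt_pos.2 (by nlinarith [hlt t ht])
  · rw [Real.sqrt_lt' one_pos]
    nlinarith [sq_pos_of_pos pos]
  · rw [sine_eq, mul_div_cancel_left₀ _ hC.ne']
    exact mem_image_of_mem _ ht

theorem CurvatureLaw.IsPrimitive.sine_div_mem_of_le (hF : L.IsPrimitive F) (hC : 0 < C) {a c : ℝ}
    (ha : a ∈ Ioo (0 : ℝ) 1 ∧ sine a / C ∈ gFun F '' L.domain) (hac : a ≤ c) (hc : c < 1) :
    c ∈ Ioo (0 : ℝ) 1 ∧ sine c / C ∈ gFun F '' L.domain := by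
  have hc0 : 0 < c := ha.1.1.trans_le hac
  obtain ⟨t, ht, hta⟩ := ha.2
  refine ⟨⟨hc0, hc⟩, hF.mem_image_gFun ht (div_pos (sine_pos ⟨by linarith, hc⟩) hC) ?_⟩
  rw [hta]
  exact div_le_div_of_nonneg_right (sine_le_sine ha.1.1.le hac) hC.le

theorem CurvatureLaw.IsPrimitive.exists_isGraph (hF : L.IsPrimitive F) (hC : 0 < C)
    (hlt : ∀ t ∈ L.domain, C * gFun F t < 1) :
    ∃ O : L.Orbit, O.F = F ∧ O.C = C ∧ O.IsGraph := by
  obtain ⟨t, ht⟩ := L.nonempty_domain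
  obtain ⟨a, ha, -⟩ := exists_sine_eq_mul_gFun hC hlt ht
  exact ⟨⟨F, C, _, a, hF, hC,
    isOpen_Ioo.inter (hF.hasPosDerivOn_gFun.isOpen_image.preimage (continuous_sine.div_const C)),
    ⟨fun a ha b hb c hc => hF.sine_div_mem_of_le hC ha hc.1 (hc.2.trans_lt hb.1.2)⟩, ha,
    fun c hc => ⟨by linarith [hc.1.1], hc.1.2⟩, fun c hc => hc.2⟩, rfl, rfl, rfl, hlt⟩

end

namespace CurvatureLaw.Orbit

variable {L : CurvatureLaw} (O : L.Orbit)

/-- The radius of the circle around the axis at which a graph ends. -/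
def innerRadius : ℝ := sInf (O.radius '' O.D)

theorem innerRadius_pos (hB : L.bound ≠ ⊤) : 0 < O.innerRadius := by
  obtain ⟨m, hm⟩ := O.isPrimitive.bddBelow_image hB
  refine (mul_pos O.C_pos (Real.exp_pos m)).trans_le
    (le_csInf ⟨_, mem_image_of_mem _ O.base_mem⟩ (forall_mem_image.2 fun c hc => ?_))
  exact mul_le_mul_of_nonneg_left
    (Real.exp_le_exp.2 (hm (mem_image_of_mem _ (O.curv_mem hc)))) O.C_pos.le

namespace IsGraph

variable {O} (h : O.IsGraph)
include h

theorem subset : O.D ⊆ Ioo 0 1 := fun c hc => by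
  rw [h.D_eq] at hc
  exact hc.1

theorem exists_curv_eq {t : ℝ} (ht : t ∈ L.domain) : ∃ c ∈ O.D, O.curv c = t := by
  obtain ⟨c, hc, hct⟩ := exists_sine_eq_mul_gFun O.C_pos h.C_mul_gFun_lt_one ht
  rw [← h.D_eq] at hc
  exact ⟨c, hc, (O.eq_curv_of_C_mul_gFun_eq hc ht hct).symm⟩

theorem not_bddAbove_image_radius : ¬ BddAbove (O.radius '' O.D) := by
  have base_mem := h.D_eq ▸ O.base_mem
  have near_one : ∀ᶠ c in 𝓝[<] (1 : ℝ), c ∈ O.D := by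
    filter_upwards [Ico_mem_nhdsLT (h.subset O.base_mem).2] with c hc
    rw [h.D_eq]
    exact O.isPrimitive.sine_div_mem_of_le O.C_pos base_mem hc.1 hc.2
  have lim : Tendsto O.radius (𝓝[<] 1) atTop :=
    (O.tendsto_radius (by norm_num [sine])).mono_left
      (le_inf inf_le_left (le_principal_iff.2 near_one))
  rintro ⟨M, hM⟩
  obtain ⟨c, hc, hMc⟩ := (near_one.and (lim.eventually_gt_atTop M)).exists
  exact hMc.not_ge (hM (mem_image_of_mem _ hc))

theorem image_radius : O.radius '' O.D = Ioi O.innerRadius :=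
  eq_Ioi_csInf (hasPosDerivOn_radius h.subset).isOpen_image
    (hasPosDerivOn_radius h.subset).ordConnected_image
    ⟨0, forall_mem_image.2 fun c _ => (O.radius_pos c).le⟩ h.not_bddAbove_image_radius

theorem isGraphTrace (z₀ : ℝ) :
    IsGraphTrace O.innerRadius ((fun c => (O.radius c, z₀ + O.height c)) '' O.D) :=
  isGraphTrace_of_image_radius_eq h.subset h.image_radius z₀

theorem innerRadius_lt {c : ℝ} (hc : c ∈ O.D) : O.innerRadius < O.radius c :=
  h.image_radius.subset (mem_image_of_mem _ hc)

theorem innerRadius_eq_zero (hB : L.bound = ⊤) : O.innerRadius = 0 := by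
  refine le_antisymm (le_of_forall_pos_lt_add fun ε hε => ?_)
    (Real.sInf_nonneg (forall_mem_image.2 fun c _ => (O.radius_pos c).le))
  have two_div_mem : 2 / ε ∈ L.domain := ⟨by positivity, hB ▸ EReal.coe_lt_top _⟩
  obtain ⟨c, hc, hcurv⟩ := h.exists_curv_eq two_div_mem
  refine (h.innerRadius_lt hc).trans ?_
  have := O.sine_div_radius hc
  rw [hcurv, div_eq_div_iff (O.radius_pos c).ne' hε.ne'] at this
  nlinarith [sine_le_one c]

theorem exists_forall_le_rate_curv (hB : L.bound ≠ ⊤) (M : ℝ) :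
    ∃ r₀ > O.innerRadius, ∀ c ∈ O.D, O.radius c < r₀ → M ≤ L.rate (O.curv c) := by
  obtain ⟨_, ⟨t, ht, rfl⟩, hMt⟩ := not_bddAbove_iff.1 (L.not_bddAbove_rate hB) M
  obtain ⟨b, hb, rfl⟩ := h.exists_curv_eq ht
  refine ⟨O.radius b, h.innerRadius_lt hb, fun c hc hcb => hMt.le.trans
    (L.monotoneOn_rate ht (O.curv_mem hc) (antitoneOn_curv h.subset hc hb ?_))⟩
  exact ((hasPosDerivOn_radius h.subset).strictMonoOn.lt_iff_lt hc hb).1 hcb |>.le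

end IsGraph

end CurvatureLaw.Orbit

/-! ### Principal curvatures of rotational surfaces -/

theorem hasDerivAt_vec3 {f g h : ℝ → ℝ} {f' g' h' t : ℝ} (hf : HasDerivAt f f' t)
    (hg : HasDerivAt g g' t) (hh : HasDerivAt h h' t) :
    HasDerivAt (fun t => (!₂[f t, g t, h t] : E3)) !₂[f', g', h'] t := by
  rw [hasDerivAt_iff_hasFDerivAt, ← hasFDerivWithinAt_univ, hasFDerivWithinAt_euclidean]
  intro i
  fin_cases i
  · exact hf.hasFDerivAt.hasFDerivWithinAt.congr_fderiv (by ext; simp)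
  · exact hg.hasFDerivAt.hasFDerivWithinAt.congr_fderiv (by ext; simp)
  · exact hh.hasFDerivAt.hasFDerivWithinAt.congr_fderiv (by ext; simp)

theorem inner_vec3 (a b c a' b' c' : ℝ) :
    inner ℝ (!₂[a, b, c] : E3) !₂[a', b', c'] = a * a' + b * b' + c * c' := by
  simp [PiLp.inner_apply, Fin.sum_univ_three]
  ring

section

variable {E : Type*} [NormedAddCommGroup E] [NormedSpace ℝ E] {X : ℝ × ℝ → E} {s θ : ℝ}

theorem fderiv_apply_fst {v : E} (hX : DifferentiableAt ℝ X (s, θ))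
    (h : HasDerivAt (fun t => X (t, θ)) v s) : fderiv ℝ X (s, θ) (1, 0) = v :=
  (hX.hasFDerivAt.comp_hasDerivAt s
    ((hasDerivAt_id s).prodMk (hasDerivAt_const s θ))).unique h

theorem fderiv_apply_snd {v : E} (hX : DifferentiableAt ℝ X (s, θ))
    (h : HasDerivAt (fun t => X (s, t)) v θ) : fderiv ℝ X (s, θ) (0, 1) = v :=
  (hX.hasFDerivAt.comp_hasDerivAt θ
    ((hasDerivAt_const θ s).prodMk (hasDerivAt_id θ))).unique h

end

theorem fderiv_fderiv_apply {E F : Type*} [NormedAddCommGroup E] [NormedSpace ℝ E]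
    [NormedAddCommGroup F] [NormedSpace ℝ F] {X : E → F} {q : E}
    (hX : DifferentiableAt ℝ (fderiv ℝ X) q) (v w : E) :
    fderiv ℝ (fderiv ℝ X) q v w = fderiv ℝ (fun r => fderiv ℝ X r w) q v := by
  rw [fderiv_clm_apply hX (differentiableAt_const w)]
  simp

theorem sqrt_sq_half_add_sub_mul (a b : ℝ) : √(((a + b) / 2) ^ 2 - a * b) = |a - b| / 2 := by
  rw [show ((a + b) / 2) ^ 2 - a * b = ((a - b) / 2) ^ 2 by ring, Real.sqrt_sq_eq_abs, abs_div,
    abs_two]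

theorem contDiffOn_two_iff_derivWithin {J : Set ℝ} (hJ : UniqueDiffOn ℝ J) {x : ℝ → ℝ} :
    ContDiffOn ℝ 2 x J ↔ DifferentiableOn ℝ x J ∧ DifferentiableOn ℝ (derivWithin x J) J ∧
      ContinuousOn (derivWithin (derivWithin x J) J) J := by
  rw [← one_add_one_eq_two, contDiffOn_succ_iff_derivWithin hJ, ← zero_add (1 : WithTop ℕ∞),
    contDiffOn_succ_iff_derivWithin hJ, contDiffOn_zero]
  simp

namespace RotSurface

variable (S : RotSurface)

/-- The derivative of `x`, one-sided at an endpoint of `J`. -/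
def dx (s : ℝ) : ℝ := derivWithin S.x S.J s

/-- The derivative of `z`, one-sided at an endpoint of `J`. -/
def dz (s : ℝ) : ℝ := derivWithin S.z S.J s

/-- The second derivative of `x`. -/
def ddx (s : ℝ) : ℝ := derivWithin S.dx S.J s

/-- The second derivative of `z`. -/
def ddz (s : ℝ) : ℝ := derivWithin S.dz S.J s

/-- The principal curvature in the direction of the profile curve. -/
def profCurv (s : ℝ) : ℝ := S.ddz s * S.dx s - S.ddx s * S.dz s

/-- The principal curvature in the direction of the rotation, off the axis. -/
def rotCurv (s : ℝ) : ℝ := S.dz s / S.x s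

theorem interior_nonempty : (interior S.J).Nonempty := by
  obtain ⟨a, ha, b, hb, hab⟩ := S.nontrivial
  have nonempty_of_lt : ∀ a ∈ S.J, ∀ b ∈ S.J, a < b → (interior S.J).Nonempty := fun a ha b hb h =>
    ⟨(a + b) / 2, interior_mono (S.interval.out ha hb) (by
      rw [interior_Icc]; exact ⟨by linarith, by linarith⟩)⟩
  rcases lt_or_gt_of_ne hab with h | h
  exacts [nonempty_of_lt a ha b hb h, nonempty_of_lt b hb a ha h]

theorem uniqueDiffOn : UniqueDiffOn ℝ S.J :=
  uniqueDiffOn_convex S.interval.convex S.interior_nonempty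

variable {S} {s θ : ℝ}

theorem hasDerivWithinAt_x (hs : s ∈ S.J) : HasDerivWithinAt S.x (S.dx s) S.J s :=
  (((contDiffOn_two_iff_derivWithin S.uniqueDiffOn).1 S.contDiffOn_x).1 s hs).hasDerivWithinAt

theorem hasDerivWithinAt_z (hs : s ∈ S.J) : HasDerivWithinAt S.z (S.dz s) S.J s :=
  (((contDiffOn_two_iff_derivWithin S.uniqueDiffOn).1 S.contDiffOn_z).1 s hs).hasDerivWithinAt

theorem hasDerivWithinAt_dx (hs : s ∈ S.J) : HasDerivWithinAt S.dx (S.ddx s) S.J s :=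
  (((contDiffOn_two_iff_derivWithin S.uniqueDiffOn).1 S.contDiffOn_x).2.1 s hs).hasDerivWithinAt

theorem hasDerivWithinAt_dz (hs : s ∈ S.J) : HasDerivWithinAt S.dz (S.ddz s) S.J s :=
  (((contDiffOn_two_iff_derivWithin S.uniqueDiffOn).1 S.contDiffOn_z).2.1 s hs).hasDerivWithinAt

theorem dx_sq_add_dz_sq (hs : s ∈ S.J) : S.dx s ^ 2 + S.dz s ^ 2 = 1 := S.arcLength s hs

theorem hasDerivAt_x (hs : s ∈ interior S.J) : HasDerivAt S.x (S.dx s) s :=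
  (hasDerivWithinAt_x (interior_subset hs)).hasDerivAt (mem_interior_iff_mem_nhds.1 hs)

theorem hasDerivAt_z (hs : s ∈ interior S.J) : HasDerivAt S.z (S.dz s) s :=
  (hasDerivWithinAt_z (interior_subset hs)).hasDerivAt (mem_interior_iff_mem_nhds.1 hs)

theorem hasDerivAt_dx (hs : s ∈ interior S.J) : HasDerivAt S.dx (S.ddx s) s :=
  (hasDerivWithinAt_dx (interior_subset hs)).hasDerivAt (mem_interior_iff_mem_nhds.1 hs)

theorem hasDerivAt_dz (hs : s ∈ interior S.J) : HasDerivAt S.dz (S.ddz s) s :=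
  (hasDerivWithinAt_dz (interior_subset hs)).hasDerivAt (mem_interior_iff_mem_nhds.1 hs)

theorem dx_mul_ddx_add_dz_mul_ddz (hs : s ∈ interior S.J) :
    S.dx s * S.ddx s + S.dz s * S.ddz s = 0 := by
  have h1 : HasDerivAt (fun t => S.dx t ^ 2 + S.dz t ^ 2)
      (2 * S.dx s ^ 1 * S.ddx s + 2 * S.dz s ^ 1 * S.ddz s) s :=
    ((hasDerivAt_dx hs).pow 2).add ((hasDerivAt_dz hs).pow 2)
  have h2 : HasDerivAt (fun t => S.dx t ^ 2 + S.dz t ^ 2) 0 s :=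
    (hasDerivAt_const s (1 : ℝ)).congr_of_eventuallyEq (by
      filter_upwards [mem_interior_iff_mem_nhds.1 hs] with t ht using dx_sq_add_dz_sq ht)
  have := h1.unique h2
  linarith

theorem contDiffAt_param (hs : s ∈ interior S.J) (θ : ℝ) :
    ContDiffAt ℝ 2 S.param (s, θ) := by
  have hx : ContDiffAt ℝ 2 (fun q : ℝ × ℝ => S.x q.1) (s, θ) :=
    (S.contDiffOn_x.contDiffAt (mem_interior_iff_mem_nhds.1 hs)).comp (s, θ) contDiffAt_fst
  have hz : ContDiffAt ℝ 2 (fun q : ℝ × ℝ => S.z q.1) (s, θ) :=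
    (S.contDiffOn_z.contDiffAt (mem_interior_iff_mem_nhds.1 hs)).comp (s, θ) contDiffAt_fst
  rw [contDiffAt_euclidean]
  intro i
  fin_cases i
  · exact hx.mul (Real.contDiff_cos.contDiffAt.comp (s, θ) contDiffAt_snd)
  · exact hx.mul (Real.contDiff_sin.contDiffAt.comp (s, θ) contDiffAt_snd)
  · exact hz

theorem fderiv_param_fst (hs : s ∈ interior S.J) (θ : ℝ) :
    fderiv ℝ S.param (s, θ) (1, 0) =
      !₂[S.dx s * Real.cos θ, S.dx s * Real.sin θ, S.dz s] :=
  fderiv_apply_fst ((contDiffAt_param hs θ).differentiableAt (by norm_num))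
    (hasDerivAt_vec3 ((hasDerivAt_x hs).mul_const (Real.cos θ))
      ((hasDerivAt_x hs).mul_const (Real.sin θ)) (hasDerivAt_z hs))

theorem fderiv_param_snd (hs : s ∈ interior S.J) (θ : ℝ) :
    fderiv ℝ S.param (s, θ) (0, 1) =
      !₂[S.x s * -Real.sin θ, S.x s * Real.cos θ, 0] :=
  fderiv_apply_snd ((contDiffAt_param hs θ).differentiableAt (by norm_num))
    (hasDerivAt_vec3 ((Real.hasDerivAt_cos θ).const_mul (S.x s))
      ((Real.hasDerivAt_sin θ).const_mul (S.x s)) (hasDerivAt_const θ (S.z s)))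

theorem differentiableAt_fderiv_param (hs : s ∈ interior S.J) (θ : ℝ) :
    DifferentiableAt ℝ (fderiv ℝ S.param) (s, θ) :=
  ((contDiffAt_param hs θ).fderiv_right (m := 1) (by norm_num)).differentiableAt (by norm_num)

theorem fderiv_fderiv_param_fst_fst (hs : s ∈ interior S.J) (θ : ℝ) :
    fderiv ℝ (fderiv ℝ S.param) (s, θ) (1, 0) (1, 0) =
      !₂[S.ddx s * Real.cos θ, S.ddx s * Real.sin θ, S.ddz s] := by
  have hd := differentiableAt_fderiv_param hs θ
  rw [fderiv_fderiv_apply hd]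
  refine fderiv_apply_fst (hd.clm_apply (differentiableAt_const _))
    (HasDerivAt.congr_of_eventuallyEq (hasDerivAt_vec3
      ((hasDerivAt_dx hs).mul_const _) ((hasDerivAt_dx hs).mul_const _) (hasDerivAt_dz hs)) ?_)
  filter_upwards [isOpen_interior.mem_nhds hs] with t ht using fderiv_param_fst ht θ

theorem fderiv_fderiv_param_fst_snd (hs : s ∈ interior S.J) (θ : ℝ) :
    fderiv ℝ (fderiv ℝ S.param) (s, θ) (1, 0) (0, 1) =
      !₂[S.dx s * -Real.sin θ, S.dx s * Real.cos θ, 0] := by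
  have hd := differentiableAt_fderiv_param hs θ
  rw [fderiv_fderiv_apply hd]
  refine fderiv_apply_fst (hd.clm_apply (differentiableAt_const _))
    (HasDerivAt.congr_of_eventuallyEq (hasDerivAt_vec3
      ((hasDerivAt_x hs).mul_const _) ((hasDerivAt_x hs).mul_const _) (hasDerivAt_const s 0)) ?_)
  filter_upwards [isOpen_interior.mem_nhds hs] with t ht using fderiv_param_snd ht θ

theorem fderiv_fderiv_param_snd_snd (hs : s ∈ interior S.J) (θ : ℝ) :
    fderiv ℝ (fderiv ℝ S.param) (s, θ) (0, 1) (0, 1) =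
      !₂[S.x s * -Real.cos θ, S.x s * -Real.sin θ, 0] := by
  have hd := differentiableAt_fderiv_param hs θ
  rw [fderiv_fderiv_apply hd]
  exact fderiv_apply_snd (hd.clm_apply (differentiableAt_const _))
    (HasDerivAt.congr_of_eventuallyEq (hasDerivAt_vec3
      ((Real.hasDerivAt_sin θ).neg.const_mul _) ((Real.hasDerivAt_cos θ).const_mul _)
      (hasDerivAt_const θ 0)) (Eventually.of_forall fun t => fderiv_param_snd hs t))

theorem firstForm_fst_fst (hs : s ∈ interior S.J) :
    firstForm S.param (s, θ) (1, 0) (1, 0) = 1 := by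
  rw [firstForm, fderiv_param_fst hs, inner_vec3]
  linear_combination S.dx s ^ 2 * Real.cos_sq_add_sin_sq θ + dx_sq_add_dz_sq (interior_subset hs)

theorem firstForm_fst_snd (hs : s ∈ interior S.J) :
    firstForm S.param (s, θ) (1, 0) (0, 1) = 0 := by
  rw [firstForm, fderiv_param_fst hs, fderiv_param_snd hs, inner_vec3]
  ring

theorem firstForm_snd_snd (hs : s ∈ interior S.J) :
    firstForm S.param (s, θ) (0, 1) (0, 1) = S.x s ^ 2 := by
  rw [firstForm, fderiv_param_snd hs, inner_vec3]
  linear_combination S.x s ^ 2 * Real.cos_sq_add_sin_sq θ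

theorem normal_eq (s θ : ℝ) :
    S.normal (s, θ) = !₂[-S.dz s * Real.cos θ, -S.dz s * Real.sin θ, S.dx s] := rfl

theorem secondForm_fst_fst (hs : s ∈ interior S.J) :
    secondForm S.param (S.normal (s, θ)) (s, θ) (1, 0) (1, 0) = S.profCurv s := by
  rw [secondForm, fderiv_fderiv_param_fst_fst hs, normal_eq, inner_vec3, profCurv]
  linear_combination -S.ddx s * S.dz s * Real.cos_sq_add_sin_sq θ

theorem secondForm_fst_snd (hs : s ∈ interior S.J) :
    secondForm S.param (S.normal (s, θ)) (s, θ) (1, 0) (0, 1) = 0 := by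
  rw [secondForm, fderiv_fderiv_param_fst_snd hs, normal_eq, inner_vec3]
  ring

theorem secondForm_snd_snd (hs : s ∈ interior S.J) :
    secondForm S.param (S.normal (s, θ)) (s, θ) (0, 1) (0, 1) = S.x s * S.dz s := by
  rw [secondForm, fderiv_fderiv_param_snd_snd hs, normal_eq, inner_vec3]
  linear_combination S.x s * S.dz s * Real.cos_sq_add_sin_sq θ

theorem areaSq_eq (hs : s ∈ interior S.J) : areaSq S.param (s, θ) = S.x s ^ 2 := by
  rw [areaSq, firstForm_fst_fst hs, firstForm_fst_snd hs, firstForm_snd_snd hs]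
  ring

theorem meanCurv_eq (hs : s ∈ interior S.J) (hx : 0 < S.x s) :
    meanCurv S.param (S.normal (s, θ)) (s, θ) = (S.profCurv s + S.rotCurv s) / 2 := by
  rw [meanCurv, areaSq_eq hs, firstForm_fst_fst hs, firstForm_fst_snd hs, firstForm_snd_snd hs,
    secondForm_fst_fst hs, secondForm_fst_snd hs, secondForm_snd_snd hs, rotCurv]
  field_simp
  ring

theorem gaussCurv_eq (hs : s ∈ interior S.J) (hx : 0 < S.x s) :
    gaussCurv S.param (S.normal (s, θ)) (s, θ) = S.profCurv s * S.rotCurv s := by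
  rw [gaussCurv, areaSq_eq hs, secondForm_fst_fst hs, secondForm_fst_snd hs,
    secondForm_snd_snd hs, rotCurv]
  field_simp
  ring

theorem kappa1_eq_max (hs : s ∈ interior S.J) (hx : 0 < S.x s) :
    kappa1 S.param (S.normal (s, θ)) (s, θ) = max (S.profCurv s) (S.rotCurv s) := by
  rw [kappa1, meanCurv_eq hs hx, gaussCurv_eq hs hx, sqrt_sq_half_add_sub_mul, abs_sub_comm,
    sup_eq_half_smul_add_add_abs_sub' ℝ, smul_eq_mul]
  ring

theorem kappa2_eq_min (hs : s ∈ interior S.J) (hx : 0 < S.x s) :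
    kappa2 S.param (S.normal (s, θ)) (s, θ) = min (S.profCurv s) (S.rotCurv s) := by
  rw [kappa2, meanCurv_eq hs hx, gaussCurv_eq hs hx, sqrt_sq_half_add_sub_mul, abs_sub_comm,
    inf_eq_half_smul_add_sub_abs_sub' ℝ, smul_eq_mul]
  ring

theorem kappa1_sq_add_kappa2_sq (hs : s ∈ interior S.J) (hx : 0 < S.x s) :
    kappa1 S.param (S.normal (s, θ)) (s, θ) ^ 2 + kappa2 S.param (S.normal (s, θ)) (s, θ) ^ 2 =
      S.profCurv s ^ 2 + S.rotCurv s ^ 2 := by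
  rw [kappa1_eq_max hs hx, kappa2_eq_min hs hx]
  rcases le_total (S.profCurv s) (S.rotCurv s) with h | h
  · rw [max_eq_right h, min_eq_left h, add_comm]
  · rw [max_eq_left h, min_eq_right h]

theorem hasDerivAt_rotCurv (hs : s ∈ interior S.J) (hx : 0 < S.x s) :
    HasDerivAt S.rotCurv (S.dx s * (S.profCurv s - S.rotCurv s) / S.x s) s := by
  refine ((hasDerivAt_dz hs).div (hasDerivAt_x hs) hx.ne').congr_deriv ?_
  rw [profCurv, rotCurv]
  field_simp
  linear_combination (-S.x s * S.ddz s) * dx_sq_add_dz_sq (interior_subset hs) +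
    S.x s * S.dz s * dx_mul_ddx_add_dz_mul_ddz hs

theorem ordConnected_interior : (interior S.J).OrdConnected :=
  S.interval.convex.interior.ordConnected

/-! ### Rotational surfaces and profile curves -/

/-- The principal curvatures of the surface over `J` are related by the law `L`, after a
multiplication of both by the sign `σ`, and the rotational one is positive after it. -/
structure HasLawOn (S : RotSurface) (L : CurvatureLaw) (σ : ℝ) (J : Set ℝ) : Prop where
  isOpen : IsOpen J
  ordConnected : J.OrdConnected
  nonempty : J.Nonempty
  subset_interior : J ⊆ interior S.J
  x_pos : ∀ s ∈ J, 0 < S.x s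
  mem_domain : ∀ s ∈ J, σ * S.rotCurv s ∈ L.domain
  profCurv_eq : ∀ s ∈ J, σ * S.profCurv s = -L.rate (σ * S.rotCurv s)

namespace HasLawOn

variable {L : CurvatureLaw} {σ : ℝ} {J : Set ℝ}

theorem sign_mul_dz_pos (h : S.HasLawOn L σ J) (hs : s ∈ J) : 0 < σ * S.dz s := by
  have := mul_pos (h.mem_domain s hs).1 (h.x_pos s hs)
  rwa [mul_assoc, rotCurv, div_mul_cancel₀ _ (h.x_pos s hs).ne'] at this

theorem dx_sq_add_sign_mul_dz_sq (h : S.HasLawOn L σ J) (hσ : σ ^ 2 = 1) (hs : s ∈ J) :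
    S.dx s ^ 2 + (σ * S.dz s) ^ 2 = 1 := by
  rw [mul_pow, hσ, one_mul, dx_sq_add_dz_sq (interior_subset (h.subset_interior hs))]

theorem dx_mem_Ioo (h : S.HasLawOn L σ J) (hσ : σ ^ 2 = 1) (hs : s ∈ J) :
    S.dx s ∈ Ioo (-1 : ℝ) 1 := by
  rw [mem_Ioo, ← abs_lt, ← sq_lt_one_iff_abs_lt_one]
  linarith [sq_pos_of_pos (h.sign_mul_dz_pos hs), h.dx_sq_add_sign_mul_dz_sq hσ hs]

theorem sine_dx (h : S.HasLawOn L σ J) (hσ : σ ^ 2 = 1) (hs : s ∈ J) :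
    sine (S.dx s) = σ * S.dz s := by
  rw [sine, ← eq_sub_of_add_eq' (h.dx_sq_add_sign_mul_dz_sq hσ hs),
    Real.sqrt_sq (h.sign_mul_dz_pos hs).le]

theorem sine_dx_div_x (h : S.HasLawOn L σ J) (hσ : σ ^ 2 = 1) (hs : s ∈ J) :
    sine (S.dx s) / S.x s = σ * S.rotCurv s := by
  rw [h.sine_dx hσ hs, rotCurv, mul_div_assoc]

/-- The profile curve over `J`, reflected in a horizontal line if `σ = -1`. -/
def profile (h : S.HasLawOn L σ J) (hσ : σ ^ 2 = 1) : L.Profile where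
  J := J
  x := S.x
  z s := σ * S.z s
  cos := S.dx
  isOpen := h.isOpen
  ordConnected := h.ordConnected
  nonempty := h.nonempty
  x_pos := h.x_pos
  cos_mem _ hs := h.dx_mem_Ioo hσ hs
  hasDerivAt_x _ hs := hasDerivAt_x (h.subset_interior hs)
  hasDerivAt_z s hs := by
    rw [h.sine_dx hσ hs]
    exact (hasDerivAt_z (h.subset_interior hs)).const_mul σ
  hasDerivAt_cos s hs := by
    rw [h.sine_dx_div_x hσ hs, h.sine_dx hσ hs]
    refine (hasDerivAt_dx (h.subset_interior hs)).congr_deriv ?_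
    have law := h.profCurv_eq s hs
    rw [profCurv] at law
    linear_combination (-S.ddx s) * h.dx_sq_add_sign_mul_dz_sq hσ hs - σ * S.dz s * law +
      S.dx s * dx_mul_ddx_add_dz_mul_ddz (h.subset_interior hs) +
      (S.ddz s * S.dz s * S.dx s) * hσ
  mem_domain s hs := by
    rw [h.sine_dx_div_x hσ hs]
    exact h.mem_domain s hs

theorem profile_rotCurv (h : S.HasLawOn L σ J) (hσ : σ ^ 2 = 1) (hs : s ∈ J) :
    (h.profile hσ).rotCurv s = σ * S.rotCurv s := h.sine_dx_div_x hσ hs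

end HasLawOn

end RotSurface

namespace CurvatureLaw.Profile

variable {L : CurvatureLaw} (P : L.Profile) {σ s : ℝ}

theorem continuousOn_rate_rotCurv : ContinuousOn (fun s => L.rate (P.rotCurv s)) P.J :=
  L.continuousOn_rate.comp (HasDerivAt.continuousOn fun _ hs => P.hasDerivAt_rotCurv hs)
    P.mem_domain

theorem derivWithin_x (hs : s ∈ P.J) : derivWithin P.x P.J s = P.cos s :=
  (P.hasDerivAt_x s hs).hasDerivWithinAt.derivWithin (P.isOpen.uniqueDiffWithinAt hs)

theorem derivWithin_mul_z (σ : ℝ) (hs : s ∈ P.J) :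
    derivWithin (fun s => σ * P.z s) P.J s = σ * sine (P.cos s) :=
  ((P.hasDerivAt_z s hs).const_mul σ).hasDerivWithinAt.derivWithin
    (P.isOpen.uniqueDiffWithinAt hs)

/-- The rotational surface with profile `P`, reflected in a horizontal plane if `σ = -1`. -/
def rotSurface (hσ : σ ^ 2 = 1) : RotSurface where
  J := P.J
  x := P.x
  z s := σ * P.z s
  interval := P.ordConnected
  nontrivial := by
    obtain ⟨a, ha⟩ := P.nonempty
    obtain ⟨e, he, hball⟩ := Metric.isOpen_iff.1 P.isOpen a ha
    exact ⟨a, ha, a + e / 2, hball (by simp [abs_of_pos, he]), by linarith⟩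
  contDiffOn_x := contDiffOn_two_of_hasDerivAt P.isOpen P.hasDerivAt_x P.hasDerivAt_cos
    (P.continuousOn_rate_rotCurv.mul
      (HasDerivAt.continuousOn fun _ hs => P.hasDerivAt_sine_cos hs))
  contDiffOn_z := contDiffOn_two_of_hasDerivAt P.isOpen
    (fun s hs => (P.hasDerivAt_z s hs).const_mul σ)
    (fun s hs => (P.hasDerivAt_sine_cos hs).const_mul σ)
    (continuousOn_const.mul
      ((HasDerivAt.continuousOn P.hasDerivAt_cos).mul P.continuousOn_rate_rotCurv).neg)
  nonneg s hs := (P.x_pos s hs).le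
  arcLength s hs := by
    rw [P.derivWithin_x hs, P.derivWithin_mul_z σ hs, mul_pow, hσ, sine_sq (P.cos_mem s hs)]
    ring
  mem_interior s hs _ := by rwa [P.isOpen.interior_eq]
  regular_on_axis s hs h0 := absurd h0 (P.x_pos s hs).ne'

theorem rotSurface_dx (hσ : σ ^ 2 = 1) (hs : s ∈ P.J) : (P.rotSurface hσ).dx s = P.cos s :=
  P.derivWithin_x hs

theorem rotSurface_dz (hσ : σ ^ 2 = 1) (hs : s ∈ P.J) :
    (P.rotSurface hσ).dz s = σ * sine (P.cos s) := P.derivWithin_mul_z σ hs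

theorem rotSurface_ddx (hσ : σ ^ 2 = 1) (hs : s ∈ P.J) :
    (P.rotSurface hσ).ddx s = L.rate (P.rotCurv s) * sine (P.cos s) :=
  (derivWithin_congr (fun _ ht => P.rotSurface_dx hσ ht) (P.rotSurface_dx hσ hs)).trans
    ((P.hasDerivAt_cos s hs).hasDerivWithinAt.derivWithin (P.isOpen.uniqueDiffWithinAt hs))

theorem rotSurface_ddz (hσ : σ ^ 2 = 1) (hs : s ∈ P.J) :
    (P.rotSurface hσ).ddz s = σ * -(P.cos s * L.rate (P.rotCurv s)) :=
  (derivWithin_congr (fun _ ht => P.rotSurface_dz hσ ht) (P.rotSurface_dz hσ hs)).trans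
    (((P.hasDerivAt_sine_cos hs).const_mul σ).hasDerivWithinAt.derivWithin
      (P.isOpen.uniqueDiffWithinAt hs))

theorem rotSurface_rotCurv (hσ : σ ^ 2 = 1) (hs : s ∈ P.J) :
    (P.rotSurface hσ).rotCurv s = σ * P.rotCurv s := by
  rw [RotSurface.rotCurv, P.rotSurface_dz hσ hs, mul_div_assoc]
  rfl

theorem rotSurface_profCurv (hσ : σ ^ 2 = 1) (hs : s ∈ P.J) :
    (P.rotSurface hσ).profCurv s = -σ * L.rate (P.rotCurv s) := by
  rw [RotSurface.profCurv, P.rotSurface_dx hσ hs, P.rotSurface_dz hσ hs,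
    P.rotSurface_ddx hσ hs, P.rotSurface_ddz hσ hs]
  linear_combination (-σ * L.rate (P.rotCurv s)) * sine_sq (P.cos_mem s hs)

theorem hasLawOn_rotSurface (hσ : σ ^ 2 = 1) : (P.rotSurface hσ).HasLawOn L σ P.J where
  isOpen := P.isOpen
  ordConnected := P.ordConnected
  nonempty := P.nonempty
  subset_interior := P.isOpen.interior_eq.ge
  x_pos := P.x_pos
  mem_domain s hs := by
    rw [P.rotSurface_rotCurv hσ hs, ← mul_assoc, ← sq, hσ, one_mul]
    exact P.mem_domain s hs
  profCurv_eq s hs := by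
    rw [P.rotSurface_rotCurv hσ hs, P.rotSurface_profCurv hσ hs, ← mul_assoc, ← mul_assoc,
      mul_neg, ← sq, hσ, one_mul, neg_one_mul]

theorem trace_rotSurface (hσ : σ ^ 2 = 1) :
    (P.rotSurface hσ).trace =
      (fun q : ℝ × ℝ => (q.1, σ * q.2)) '' ((fun s => (P.x s, P.z s)) '' P.J) :=
  (image_image (fun q : ℝ × ℝ => (q.1, σ * q.2)) (fun s => (P.x s, P.z s)) P.J).symm

theorem IsArcOf.isOpenPiece {S : RotSurface} {P : L.Profile} (hσ : σ ^ 2 = 1)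
    (h : S.HasLawOn L σ S.J) (hP : (h.profile hσ).IsArcOf P) :
    S.IsOpenPiece (P.rotSurface hσ) := by
  obtain ⟨a, ha⟩ := hP
  refine ⟨a, fun s hs => ⟨(ha s hs).1, (ha s hs).2.1, ?_⟩⟩
  change S.z s = σ * P.z (s + a)
  rw [← (ha s hs).2.2]
  change S.z s = σ * (σ * S.z s)
  linear_combination (-S.z s) * hσ

end CurvatureLaw.Profile

/-! ### The curvature laws of an elliptic class with umbilical constant `0` -/

namespace EllipticClass

variable {W : EllipticClass} {t y : ℝ}

theorem continuousOn_g (hα : W.α = 0) : ContinuousOn W.g (Ici 0) :=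
  hα ▸ W.contDiffOn.continuousOn

theorem hasDerivWithinAt_g (hα : W.α = 0) (ht : 0 ≤ t) :
    HasDerivWithinAt W.g (derivWithin W.g (Ici 0) t) (Ici 0) t := by
  have := W.contDiffOn.differentiableOn (by norm_num)
  rw [hα] at this
  exact (this t ht).hasDerivWithinAt

theorem derivWithin_g_neg (hα : W.α = 0) (ht : 0 ≤ t) :
    derivWithin W.g (Ici 0) t < 0 := by
  have := W.deriv_neg t (by rw [hα]; exact ht)
  rwa [hα] at this

theorem hasDerivAt_g (hα : W.α = 0) (ht : 0 < t) :
    HasDerivAt W.g (derivWithin W.g (Ici 0) t) t :=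
  (hasDerivWithinAt_g hα ht.le).hasDerivAt (Ici_mem_nhds ht)

theorem strictAntiOn_g (hα : W.α = 0) : StrictAntiOn W.g (Ici 0) := by
  refine strictAntiOn_of_deriv_neg (convex_Ici 0) (continuousOn_g hα) fun t ht => ?_
  rw [interior_Ici] at ht
  rw [(hasDerivAt_g hα ht).deriv]
  exact derivWithin_g_neg hα (le_of_lt ht)

theorem g_zero (hα : W.α = 0) : W.g 0 = 0 := by
  have := W.fixed
  rwa [hα] at this

theorem tendsto_b (hα : W.α = 0) : Tendsto (fun t : ℝ => (W.g t : EReal)) atTop (𝓝 W.b) := by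
  have hanti : Antitone fun t : ℝ => ((W.g (max t 0) : ℝ) : EReal) := fun s t hst =>
    EReal.coe_le_coe_iff.2 ((strictAntiOn_g hα).antitoneOn (le_max_right s 0) (le_max_right t 0)
      (max_le_max_right 0 hst))
  have h : Tendsto (fun t : ℝ => (W.g t : EReal)) atTop
      (𝓝 (⨅ t : ℝ, ((W.g (max t 0) : ℝ) : EReal))) := by
    refine (tendsto_atTop_iInf hanti).congr' ?_
    filter_upwards [eventually_ge_atTop 0] with t ht
    rw [max_eq_left ht]
  rw [b, h.limUnder_eq]
  exact h

theorem b_lt_g (hα : W.α = 0) (ht : 0 ≤ t) : W.b < W.g t := by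
  have h1 : W.b ≤ W.g (t + 1) := by
    refine le_of_tendsto (tendsto_b hα) ?_
    filter_upwards [eventually_ge_atTop (t + 1)] with u hu
    exact EReal.coe_le_coe_iff.2 ((strictAntiOn_g hα).antitoneOn
      (show (0 : ℝ) ≤ t + 1 by linarith) (show (0 : ℝ) ≤ u by linarith) hu)
  exact h1.trans_lt (EReal.coe_lt_coe_iff.2 (strictAntiOn_g hα ht
    (show (0 : ℝ) ≤ t + 1 by linarith) (lt_add_one t)))

theorem b_neg (hα : W.α = 0) : W.b < 0 := by
  have := b_lt_g hα le_rfl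
  rwa [g_zero hα, EReal.coe_zero] at this

theorem exists_g_eq (hα : W.α = 0) (hy : W.b < y) (hy0 : y ≤ 0) :
    ∃ t, 0 ≤ t ∧ W.g t = y := by
  obtain ⟨t, ht, ht0⟩ := (((tendsto_b hα).eventually (gt_mem_nhds hy)).and
    (eventually_ge_atTop 0)).exists
  obtain ⟨u, hu, huy⟩ := intermediate_value_Icc' ht0
    ((continuousOn_g hα).mono Icc_subset_Ici_self)
    ⟨(EReal.coe_lt_coe_iff.1 ht).le, hy0.trans (g_zero hα).ge⟩
  exact ⟨u, hu.1, huy⟩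

theorem g_neg (hα : W.α = 0) (ht : 0 < t) : W.g t < 0 := by
  rw [← g_zero hα]
  exact strictAntiOn_g hα self_mem_Ici ht.le ht

theorem g_nonpos (hα : W.α = 0) (ht : 0 ≤ t) : W.g t ≤ 0 := by
  rw [← g_zero hα]
  exact (strictAntiOn_g hα).antitoneOn self_mem_Ici ht ht

theorem f_of_nonneg (hα : W.α = 0) (ht : 0 ≤ t) : W.f t = W.g t := by
  rw [f, if_pos (hα.le.trans ht)]

theorem f_g (hα : W.α = 0) (ht : 0 ≤ t) : W.f (W.g t) = t := by
  rcases ht.eq_or_lt with rfl | ht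
  · rw [g_zero hα, f_of_nonneg hα le_rfl, g_zero hα]
  · rw [f, if_neg (by rw [hα]; exact not_le.2 (g_neg hα ht)), hα]
    exact (strictAntiOn_g hα).injOn.leftInvOn_invFunOn ht.le

theorem min_eq_g_max_iff (hα : W.α = 0) {k l : ℝ} :
    (0 ≤ max k l ∧ min k l = W.g (max k l)) ↔ (W.b < l ∧ k = W.f l) := by
  constructor
  · rintro ⟨h0, h⟩
    rcases le_total k l with hkl | hkl
    · rw [max_eq_right hkl] at h0 h
      rw [min_eq_left hkl] at h
      exact ⟨(b_neg hα).trans_le (by exact_mod_cast h0), by rw [f_of_nonneg hα h0, h]⟩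
    · rw [max_eq_left hkl] at h0 h
      rw [min_eq_right hkl] at h
      rw [h]
      exact ⟨b_lt_g hα h0, (f_g hα h0).symm⟩
  · rintro ⟨hb, rfl⟩
    rcases le_total 0 l with hl | hl
    · have := g_nonpos hα hl
      rw [f_of_nonneg hα hl, max_eq_right (this.trans hl), min_eq_left (this.trans hl)]
      exact ⟨hl, rfl⟩
    · obtain ⟨t, ht, rfl⟩ := exists_g_eq hα hb hl
      rw [f_g hα ht, max_eq_left (hl.trans ht), min_eq_right (hl.trans ht)]
      exact ⟨ht, rfl⟩

theorem exists_linear_bounds_g (hα : W.α = 0) : ∃ k K δ : ℝ, 0 < k ∧ 0 < K ∧ 0 < δ ∧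
    ∀ t, 0 < t → t ≤ δ → k * t ≤ -W.g t ∧ -W.g t ≤ K * t := by
  have hd := derivWithin_g_neg hα le_rfl
  have h := hasDerivWithinAt_g hα le_rfl
  rw [← hasDerivWithinAt_Ioi_iff_Ici, hasDerivWithinAt_iff_tendsto_slope' (by simp)] at h
  set d := derivWithin W.g (Ici 0) 0
  have h2 := h.eventually (Ioo_mem_nhds (show 2 * d < d by linarith)
    (show d < d / 2 by linarith))
  obtain ⟨δ, hδ, hsub⟩ := (mem_nhdsGT_iff_exists_Ioc_subset).1 h2
  refine ⟨-(d / 2), -(2 * d), δ, by linarith, by linarith, hδ, fun t ht htδ => ?_⟩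
  have := hsub ⟨ht, htδ⟩
  simp only [slope_def_field, g_zero hα, sub_zero, mem_ofPred_eq] at this
  rw [lt_div_iff₀ ht, div_lt_iff₀ ht] at this
  constructor <;> linarith [this.1, this.2]

theorem posBelow_neg_b (hα : W.α = 0) : posBelow (-W.b) = (fun t => -W.g t) '' Ioi 0 := by
  refine Subset.antisymm (fun y hy => ?_) (image_subset_iff.2 fun t (ht : 0 < t) =>
    ⟨neg_pos.2 (g_neg hα ht), ?_⟩)
  · obtain ⟨t, ht, hty⟩ := exists_g_eq hα (y := -y)
      (by rw [EReal.coe_neg]; exact EReal.lt_neg_comm.1 hy.2) (neg_nonpos.2 hy.1.le)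
    refine ⟨t, ht.lt_of_ne' ?_, by simp [hty]⟩
    rintro rfl
    linarith [hy.1, g_zero hα]
  · rw [EReal.coe_neg]
    exact EReal.neg_lt_neg_iff.2 (b_lt_g hα ht.le)

theorem hasPosDerivOn_neg_g (hα : W.α = 0) :
    HasPosDerivOn (fun t => -W.g t) (fun t => -derivWithin W.g (Ici 0) t) (Ioi 0) where
  isOpen := isOpen_Ioi
  ordConnected := ordConnected_Ioi
  hasDerivAt _ ht := (hasDerivAt_g hα ht).neg
  pos _ ht := neg_pos.2 (derivWithin_g_neg hα (le_of_lt ht))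

variable (W) in
/-- The law of the profile curves whose rotational principal curvature is positive: the other
principal curvature is then `κ₂`. -/
def posLaw (hα : W.α = 0) : CurvatureLaw where
  bound := ⊤
  rate t := -W.g t
  bound_pos := EReal.zero_lt_top
  continuousOn_rate := ((continuousOn_g hα).mono fun _ ht => ht.1.le).neg
  rate_pos _ ht := neg_pos.2 (g_neg hα ht.1)
  monotoneOn_rate _ ht _ hu htu :=
    neg_le_neg ((strictAntiOn_g hα).antitoneOn ht.1.le hu.1.le htu)
  linear_near_zero := by
    obtain ⟨k, K, δ, hk, hK, hδ, h⟩ := exists_linear_bounds_g hα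
    exact ⟨k, K, δ, hk, hK, ⟨hδ, EReal.coe_lt_top _⟩, h⟩
  not_bddAbove_rate h := absurd rfl h

variable (W) in
/-- The law of the profile curves whose rotational principal curvature is negative, for the
opposite normal: the other principal curvature is then `κ₁`, and the law inverts that of
`posLaw`. -/
def negLaw (hα : W.α = 0) : CurvatureLaw where
  bound := -W.b
  rate t := W.f (-t)
  bound_pos := by simpa using EReal.neg_lt_neg_iff.2 (b_neg hα)
  continuousOn_rate := by
    rw [posBelow_neg_b hα]
    refine ContinuousOn.congr (f := Function.invFunOn (fun t => -W.g t) (Ioi 0))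
      (forall_mem_image.2 fun t ht => ?_) (forall_mem_image.2 fun t ht => ?_)
    · exact ((hasPosDerivOn_neg_g hα).hasDerivAt_invFunOn ht).continuousAt.continuousWithinAt
    · change W.f (-(-W.g t)) = _
      rw [neg_neg, f_g hα (le_of_lt ht), (hasPosDerivOn_neg_g hα).invFunOn_apply ht]
  rate_pos := by
    rw [posBelow_neg_b hα]
    refine forall_mem_image.2 fun t ht => ?_
    rwa [neg_neg, f_g hα (le_of_lt ht)]
  monotoneOn_rate := by
    rw [posBelow_neg_b hα]
    rintro _ ⟨t, ht, rfl⟩ _ ⟨u, hu, rfl⟩ htu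
    simp only [neg_neg, f_g hα (le_of_lt ht), f_g hα (le_of_lt hu)]
    exact ((hasPosDerivOn_neg_g hα).strictMonoOn.le_iff_le ht hu).1 htu
  linear_near_zero := by
    obtain ⟨k, K, δ, hk, hK, hδ, h⟩ := exists_linear_bounds_g hα
    have hmem : -W.g δ ∈ posBelow (-W.b) := posBelow_neg_b hα ▸ mem_image_of_mem _ hδ
    refine ⟨K⁻¹, k⁻¹, -W.g δ, inv_pos.2 hK, inv_pos.2 hk, hmem, fun y hy hyδ => ?_⟩
    obtain ⟨t, ht, rfl⟩ := (posBelow_neg_b hα).subset (mem_posBelow_of_le hmem hy hyδ)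
    obtain ⟨h1, h2⟩ := h t ht (((hasPosDerivOn_neg_g hα).strictMonoOn.le_iff_le ht hδ).1 hyδ)
    rw [neg_neg, f_g hα (le_of_lt ht), inv_mul_le_iff₀ hK, le_inv_mul_iff₀ hk]
    exact ⟨h2, h1⟩
  not_bddAbove_rate _ := by
    have hsub : Ioi 0 ⊆ (fun t => W.f (-t)) '' posBelow (-W.b) := by
      rw [posBelow_neg_b hα, image_image]
      exact fun t ht => ⟨t, ht, by simp only [neg_neg, f_g hα (le_of_lt ht)]⟩
    exact fun h => not_bddAbove_Ioi 0 (h.mono hsub)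

variable (W) in
/-- The law of the profile curves whose rotational principal curvature has the sign `σ`. -/
def law (hα : W.α = 0) (σ : ℝ) : CurvatureLaw := if σ = 1 then W.posLaw hα else W.negLaw hα

theorem law_one (hα : W.α = 0) : W.law hα 1 = W.posLaw hα := if_pos rfl

theorem law_neg_one (hα : W.α = 0) : W.law hα (-1) = W.negLaw hα := if_neg (by norm_num)

variable {σ l : ℝ}

theorem mul_mem_domain_law_iff (hα : W.α = 0) (hσ : σ ^ 2 = 1) (hl : 0 < σ * l) :
    σ * l ∈ (W.law hα σ).domain ↔ W.b < l := by
  rcases sq_eq_one_iff.1 hσ with rfl | rfl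
  · rw [one_mul] at hl ⊢
    exact ⟨fun _ => (b_neg hα).trans (EReal.coe_pos.2 hl),
      fun _ => law_one hα ▸ ⟨hl, EReal.coe_lt_top _⟩⟩
  · rw [neg_one_mul] at hl ⊢
    rw [law_neg_one, ← EReal.neg_lt_neg_iff, ← EReal.coe_neg]
    exact ⟨fun h => h.2, fun h => ⟨hl, h⟩⟩

theorem mul_f_eq_neg_rate (hα : W.α = 0) (hσ : σ ^ 2 = 1) (hl : 0 < σ * l) :
    σ * W.f l = -(W.law hα σ).rate (σ * l) := by
  rcases sq_eq_one_iff.1 hσ with rfl | rfl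
  · rw [one_mul] at hl ⊢
    rw [one_mul, law_one, f_of_nonneg hα hl.le]
    exact (neg_neg _).symm
  · rw [law_neg_one, neg_one_mul, neg_one_mul]
    change -W.f l = -W.f (-(-l))
    rw [neg_neg]

theorem f_zero (hα : W.α = 0) : W.f 0 = 0 := by
  rw [f_of_nonneg hα le_rfl, g_zero hα]

theorem bound_law_eq_top_iff (hα : W.α = 0) (hσ : σ ^ 2 = 1) :
    (W.law hα σ).bound = ⊤ ↔ σ = 1 ∨ W.b = ⊥ := by
  rcases sq_eq_one_iff.1 hσ with rfl | rfl
  · simp [law_one, posLaw]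
  · norm_num [law_neg_one, negLaw]

end EllipticClass

namespace IsGFunction

open EllipticClass

variable {W : EllipticClass} {G : ℝ → ℝ}

theorem exists_isPrimitive_posLaw (hG : IsGFunction W G) (hα : W.α = 0) :
    ∃ F, (W.posLaw hα).IsPrimitive F ∧
      (FiniteAtTop G ↔ BddAbove (gFun F '' (W.posLaw hα).domain)) := by
  obtain ⟨F, hF⟩ := hG
  have gFun_data : ∀ t : ℝ, 0 < t → HasDerivAt F (1 / (W.f t - t)) t ∧ G t = gFun F t :=
    fun t ht => hF t ((b_neg hα).trans (EReal.coe_pos.2 ht)) (hα ▸ ht.ne')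
  have primitive : (W.posLaw hα).IsPrimitive F := fun t ht => by
    refine (gFun_data t ht.1).1.congr_deriv ?_
    rw [f_of_nonneg hα ht.1.le, one_div, ← inv_neg, neg_add, ← sub_eq_add_neg]
    exact congrArg (fun y => (y - t)⁻¹) (neg_neg _).symm
  refine ⟨F, primitive, ?_⟩
  rw [← exists_tendsto_atBelow_iff (W.posLaw hα).bound_pos
    primitive.hasPosDerivOn_gFun.strictMonoOn.monotoneOn, FiniteAtTop, atTop_eq_atBelow_top]
  refine exists_congr fun L => tendsto_congr' ?_
  filter_upwards [eventually_atBelow (EReal.coe_lt_top 0)] with t ht using (gFun_data t ht.1).2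

theorem exists_isPrimitive_negLaw (hG : IsGFunction W G) (hα : W.α = 0) :
    ∃ F, (W.negLaw hα).IsPrimitive F ∧
      (FiniteAtB W G ↔ BddAbove (gFun F '' (W.negLaw hα).domain)) := by
  obtain ⟨F, hF⟩ := hG
  have gFun_data : ∀ t : ℝ, 0 < t → t < -W.b →
      HasDerivAt F (1 / (W.f (-t) - -t)) (-t) ∧ G (-t) = gFun F (-t) := fun t ht htb =>
    hF (-t) (by rw [EReal.coe_neg]; exact EReal.lt_neg_comm.1 htb)
      (hα ▸ (neg_lt_zero.2 ht).ne)
  have primitive : (W.negLaw hα).IsPrimitive fun t => F (-t) := fun t ht => by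
    refine ((gFun_data t ht.1 ht.2).1.scomp t (hasDerivAt_neg t)).congr_deriv ?_
    rw [smul_eq_mul, neg_one_mul, one_div, sub_neg_eq_add]
    rfl
  have gFun_eq : ∀ᶠ t in atBelow (-W.b), gFun (fun t => F (-t)) t = -G (-t) := by
    filter_upwards [eventually_atBelow (W.negLaw hα).bound_pos] with t ht
    rw [(gFun_data t ht.1 ht.2).2, gFun, gFun, neg_mul, neg_neg]
  refine ⟨_, primitive, ?_⟩
  rw [← exists_tendsto_atBelow_iff (W.negLaw hα).bound_pos
    primitive.hasPosDerivOn_gFun.strictMonoOn.monotoneOn]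
  constructor
  · rintro ⟨L, hL⟩
    exact ⟨-L, (hL.comp (tendsto_neg_atBelow W.b)).neg.congr' (gFun_eq.mono fun t ht => ht.symm)⟩
  · rintro ⟨L, hL⟩
    refine ⟨-L, (((hL.congr' gFun_eq).comp (tendsto_neg_atAbove W.b)).neg).congr fun t => ?_⟩
    simp

end IsGFunction

/-! ### Surfaces of the class -/

theorem eq_zero_of_abs_hasDerivAt_le {f f' : ℝ → ℝ} {K a b : ℝ}
    (hf : ∀ t ∈ uIcc a b, HasDerivAt f (f' t) t) (hle : ∀ t ∈ uIcc a b, |f' t| ≤ K * |f t|)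
    (ha : f a = 0) : f b = 0 := by
  rcases le_total a b with hab | hba
  · rw [uIcc_of_le hab] at hf hle
    exact eq_zero_of_abs_deriv_le_mul_abs_self_of_eq_zero_right (HasDerivAt.continuousOn hf)
      (fun t ht => (hf t (Ico_subset_Icc_self ht)).hasDerivWithinAt) ha
      (fun t ht => hle t (Ico_subset_Icc_self ht)) b (right_mem_Icc.2 hab)
  · rw [uIcc_of_ge hba] at hf hle
    have reflected : ∀ t ∈ Icc (-a) (-b), HasDerivAt (fun t => f (-t)) (-f' (-t)) t ∧
        |-f' (-t)| ≤ K * |f (-t)| := fun t ht => by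
      have ht' : -t ∈ Icc b a := ⟨le_neg.1 ht.2, neg_le.1 ht.1⟩
      exact ⟨((hf _ ht').scomp t (hasDerivAt_neg t)).congr_deriv (by simp),
        (abs_neg _).trans_le (hle _ ht')⟩
    have := eq_zero_of_abs_deriv_le_mul_abs_self_of_eq_zero_right
      (HasDerivAt.continuousOn fun t ht => (reflected t ht).1)
      (fun t ht => (reflected t (Ico_subset_Icc_self ht)).1.hasDerivWithinAt)
      (by rwa [neg_neg]) (fun t ht => (reflected t (Ico_subset_Icc_self ht)).2)
      (-b) (right_mem_Icc.2 (neg_le_neg hba))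
    rwa [neg_neg] at this

theorem exists_sign_mul_pos {J : Set ℝ} (hJ : J.OrdConnected) {f : ℝ → ℝ}
    (hf : ContinuousOn f J) (h0 : ∀ s ∈ J, f s ≠ 0) :
    ∃ σ : ℝ, σ ^ 2 = 1 ∧ ∀ s ∈ J, 0 < σ * f s := by
  by_cases h : ∃ s ∈ J, 0 < f s
  · obtain ⟨a, ha, hpos⟩ := h
    refine ⟨1, one_pow 2, fun s hs => ?_⟩
    by_contra! hneg
    obtain ⟨t, ht, ht0⟩ := hJ.isPreconnected.intermediate_value hs ha hf
      ⟨by linarith, hpos.le⟩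
    exact h0 t ht ht0
  · push Not at h
    refine ⟨-1, by norm_num, fun s hs => ?_⟩
    linarith [(h s hs).lt_of_ne (h0 s hs)]

theorem abs_sign {σ : ℝ} (hσ : σ ^ 2 = 1) : |σ| = 1 := by
  rcases sq_eq_one_iff.1 hσ with rfl | rfl <;> simp

theorem hasDerivAt_comp_abs_zero {w : ℝ → ℝ}
    (hw : DifferentiableAt ℝ (fun p : EuclideanSpace ℝ (Fin 2) => w ‖p‖) 0) :
    HasDerivAt (fun r : ℝ => w |r|) 0 0 := by
  let e : EuclideanSpace ℝ (Fin 2) := EuclideanSpace.single 0 1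
  have diff : DifferentiableAt ℝ (fun r : ℝ => w |r|) 0 := by
    have along_e := (show DifferentiableAt ℝ (fun p : EuclideanSpace ℝ (Fin 2) => w ‖p‖)
      ((0 : ℝ) • e) by rwa [zero_smul]).comp (0 : ℝ)
        (f := fun r : ℝ => r • e) (by fun_prop)
    refine along_e.congr_of_eventuallyEq (Eventually.of_forall fun r => ?_)
    simp [e, norm_smul]
  have deriv_zero : deriv (fun r : ℝ => w |r|) 0 = 0 := by
    have := deriv_comp_neg (fun r : ℝ => w |r|) 0
    simp only [abs_neg, neg_zero] at this
    linarith
  have := diff.hasDerivAt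
  rwa [deriv_zero] at this

namespace EllipticClass

variable {W : EllipticClass} {σ : ℝ} {A : Set ℝ}

theorem exists_abs_f_le_of_sign (hα : W.α = 0) (hσ : σ ^ 2 = 1) (hA : IsCompact A)
    (hb : ∀ l ∈ A, W.b < l) : ∃ K, 0 ≤ K ∧ ∀ l ∈ A, 0 < σ * l → |W.f l| ≤ K * |l| := by
  by_cases h : ∃ l ∈ A, 0 < σ * l
  · obtain ⟨l₀, hl₀, hpos⟩ := h
    obtain ⟨m, hm, hmax⟩ := hA.exists_isMaxOn ⟨l₀, hl₀⟩
      (by fun_prop : ContinuousOn (fun l => σ * l) A)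
    have m_mem := (mul_mem_domain_law_iff hα hσ (hpos.trans_le (hmax hl₀))).2 (hb m hm)
    obtain ⟨K, hK, rate_le⟩ := (W.law hα σ).exists_rate_le_mul m_mem
    have abs_mul_sign : ∀ y : ℝ, |σ * y| = |y| := fun y => by
      rw [abs_mul, abs_sign hσ, one_mul]
    refine ⟨K, hK.le, fun l hl hl0 => ?_⟩
    rw [← abs_mul_sign, ← abs_mul_sign l, mul_f_eq_neg_rate hα hσ hl0, abs_neg, abs_of_pos hl0,
      abs_of_pos ((W.law hα σ).rate_pos _ ((mul_mem_domain_law_iff hα hσ hl0).2 (hb l hl)))]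
    exact rate_le _ hl0 (hmax hl)
  · exact ⟨0, le_rfl, fun l hl hl0 => absurd ⟨l, hl, hl0⟩ h⟩

theorem exists_abs_f_le (hα : W.α = 0) (hA : IsCompact A) (hb : ∀ l ∈ A, W.b < l) :
    ∃ K, 0 ≤ K ∧ ∀ l ∈ A, |W.f l| ≤ K * |l| := by
  obtain ⟨K₁, hK₁, le₁⟩ := exists_abs_f_le_of_sign hα (one_pow 2) hA hb
  obtain ⟨K₂, -, le₂⟩ := exists_abs_f_le_of_sign hα (σ := -1) (by norm_num) hA hb
  refine ⟨max K₁ K₂, le_max_of_le_left hK₁, fun l hl => ?_⟩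
  rcases lt_trichotomy l 0 with h | rfl | h
  · exact (le₂ l hl (by linarith)).trans
      (mul_le_mul_of_nonneg_right (le_max_right _ _) (abs_nonneg l))
  · rw [f_zero hα, abs_zero, mul_zero]
  · exact (le₁ l hl (by linarith)).trans
      (mul_le_mul_of_nonneg_right (le_max_left _ _) (abs_nonneg l))

end EllipticClass

namespace CurvatureLaw.Profile

variable {L : CurvatureLaw} (P : L.Profile)

theorem exists_pos_le_x (hB : L.bound ≠ ⊤) : ∃ m, 0 < m ∧ ∀ s ∈ P.J, m ≤ P.x s := by
  obtain ⟨F, hF⟩ := L.exists_isPrimitive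
  obtain ⟨C, hC, integral⟩ := P.exists_hasFirstIntegral hF
  obtain ⟨m, hm⟩ := hF.bddBelow_image hB
  refine ⟨C * Real.exp m, mul_pos hC (Real.exp_pos m), fun s hs => ?_⟩
  rw [integral s hs]
  exact mul_le_mul_of_nonneg_left
    (Real.exp_le_exp.2 (hm (mem_image_of_mem F (P.mem_domain s hs)))) hC.le

theorem exists_pos_le_x_of_rotCurv_le (M : ℝ) :
    ∃ m, 0 < m ∧ ∀ s ∈ P.J, P.rotCurv s ≤ M → m ≤ P.x s := by
  by_cases hB : L.bound = ⊤
  · obtain ⟨F, hF⟩ := L.exists_isPrimitive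
    obtain ⟨C, hC, integral⟩ := P.exists_hasFirstIntegral hF
    refine ⟨C * Real.exp (F M), mul_pos hC (Real.exp_pos _), fun s hs hM => ?_⟩
    have M_mem : M ∈ L.domain := ⟨(P.mem_domain s hs).1.trans_le hM, hB ▸ EReal.coe_lt_top M⟩
    rw [integral s hs]
    exact mul_le_mul_of_nonneg_left
      (Real.exp_le_exp.2 (hF.antitoneOn (P.mem_domain s hs) M_mem hM)) hC.le
  · obtain ⟨m, hm, hle⟩ := P.exists_pos_le_x hB
    exact ⟨m, hm, fun s hs _ => hle s hs⟩

end CurvatureLaw.Profile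

namespace RotSurface

open EllipticClass

variable {W : EllipticClass} {S : RotSurface} {σ s : ℝ}

theorem inClass_iff (hα : W.α = 0) : S.InClass W ↔ ∀ s ∈ S.J, 0 < S.x s →
    W.b < S.rotCurv s ∧ S.profCurv s = W.f (S.rotCurv s) := by
  refine forall₃_congr fun s hs hx => ?_
  have hs' := S.mem_interior s hs hx
  simp only [kappa1_eq_max hs' hx, kappa2_eq_min hs' hx, hα, forall_const]
  exact min_eq_g_max_iff hα

theorem HasLawOn.inClass {hα : W.α = 0} (h : S.HasLawOn (W.law hα σ) σ S.J) (hσ : σ ^ 2 = 1) :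
    S.InClass W := by
  refine (inClass_iff hα).2 fun s hs _ => ?_
  have rot_pos := (h.mem_domain s hs).1
  refine ⟨(mul_mem_domain_law_iff hα hσ rot_pos).1 (h.mem_domain s hs), ?_⟩
  exact mul_left_cancel₀ (left_ne_zero_of_mul rot_pos.ne')
    ((h.profCurv_eq s hs).trans (mul_f_eq_neg_rate hα hσ rot_pos).symm)

theorem dz_eq_zero_of_x_eq_zero (hs : s ∈ S.J) (h0 : S.x s = 0) : S.dz s = 0 := by
  obtain ⟨w, hw, hz⟩ := S.regular_on_axis s hs h0
  have deriv_z : HasDerivWithinAt S.z (0 * S.dx s) S.J s := by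
    have := HasDerivAt.comp_hasDerivWithinAt s (h₂ := fun r : ℝ => w |r|)
      (by rw [h0]; exact hasDerivAt_comp_abs_zero (hw.differentiableAt (by norm_num)))
      (hasDerivWithinAt_x hs)
    refine this.congr_of_eventuallyEq_of_mem ?_ hs
    filter_upwards [hz, self_mem_nhdsWithin] with t ht htJ
    simp only [Function.comp, abs_of_nonneg (S.nonneg t htJ), ht]
  rw [zero_mul] at deriv_z
  exact (S.uniqueDiffOn s hs).eq_deriv _ (hasDerivWithinAt_z hs) deriv_z

theorem dx_ne_zero_of_x_eq_zero (hs : s ∈ S.J) (h0 : S.x s = 0) : S.dx s ≠ 0 := fun h => by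
  have := dx_sq_add_dz_sq hs
  rw [h, dz_eq_zero_of_x_eq_zero hs h0] at this
  norm_num at this

theorem x_pos_of_mem_interior (hs : s ∈ interior S.J) : 0 < S.x s := by
  have hsJ := interior_subset hs
  refine (S.nonneg s hsJ).lt_of_ne fun h0 => dx_ne_zero_of_x_eq_zero hsJ h0.symm ?_
  refine IsLocalMin.hasDerivAt_eq_zero (f := S.x) ?_ (hasDerivAt_x hs)
  filter_upwards [mem_interior_iff_mem_nhds.1 hs] with t ht
  exact h0 ▸ S.nonneg t ht

theorem continuousOn_rotCurv : ContinuousOn S.rotCurv (interior S.J) :=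
  HasDerivAt.continuousOn fun _ hs => hasDerivAt_rotCurv hs (x_pos_of_mem_interior hs)

theorem abs_dx_le_one (hs : s ∈ S.J) : |S.dx s| ≤ 1 := by
  rw [← sq_le_one_iff_abs_le_one]
  linarith [dx_sq_add_dz_sq hs, sq_nonneg (S.dz s)]

theorem rotCurv_eq_zero (hα : W.α = 0) (hS : S.InClass W) {a b : ℝ} (ha : a ∈ interior S.J)
    (hb : b ∈ interior S.J) (h0 : S.rotCurv a = 0) : S.rotCurv b = 0 := by
  have sub : uIcc a b ⊆ interior S.J := ordConnected_interior.uIcc_subset ha hb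
  have x_pos : ∀ s ∈ uIcc a b, 0 < S.x s := fun s hs => x_pos_of_mem_interior (sub hs)
  have curv : ∀ s ∈ uIcc a b, W.b < S.rotCurv s ∧ S.profCurv s = W.f (S.rotCurv s) :=
    fun s hs => (inClass_iff hα).1 hS s (interior_subset (sub hs)) (x_pos s hs)
  obtain ⟨K, hK, f_le⟩ := exists_abs_f_le hα
    (isCompact_uIcc.image_of_continuousOn (continuousOn_rotCurv.mono sub))
    (forall_mem_image.2 fun s hs => (curv s hs).1)
  obtain ⟨m, hm, x_min⟩ := isCompact_uIcc.exists_isMinOn nonempty_uIcc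
    (HasDerivAt.continuousOn fun s hs => hasDerivAt_x (S := S) (sub hs))
  refine eq_zero_of_abs_hasDerivAt_le (K := (K + 1) / S.x m)
    (fun s hs => hasDerivAt_rotCurv (sub hs) (x_pos s hs)) (fun s hs => ?_) h0
  have sub_le : |S.profCurv s - S.rotCurv s| ≤ (K + 1) * |S.rotCurv s| := by
    have := (curv s hs).2 ▸ f_le _ (mem_image_of_mem _ hs)
    exact (abs_sub _ _).trans (by linarith)
  rw [abs_div, abs_mul, abs_of_pos (x_pos s hs), div_mul_eq_mul_div]
  refine div_le_div₀ (by positivity) ?_ (x_pos m hm) (x_min hs)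
  exact (mul_le_of_le_one_left (abs_nonneg _)
    (abs_dx_le_one (interior_subset (sub hs)))).trans sub_le

theorem tendsto_rotCurv_of_x_eq_zero (hs : s ∈ S.J) (h0 : S.x s = 0) :
    Tendsto S.rotCurv (𝓝[interior S.J] s) (𝓝 (S.ddz s / S.dx s)) := by
  have x_ne : ∀ t ∈ interior S.J, t ≠ s := by
    rintro t ht rfl
    exact (x_pos_of_mem_interior ht).ne' h0
  have lim_slope : Tendsto (fun t => slope S.dz s t / slope S.x s t) (𝓝[interior S.J] s)
      (𝓝 (S.ddz s / S.dx s)) :=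
    ((hasDerivWithinAt_iff_tendsto_slope.1 (hasDerivWithinAt_dz hs)).div
      (hasDerivWithinAt_iff_tendsto_slope.1 (hasDerivWithinAt_x hs))
      (dx_ne_zero_of_x_eq_zero hs h0)).mono_left
        (nhdsWithin_mono _ fun t ht => ⟨interior_subset ht, x_ne t ht⟩)
  refine lim_slope.congr' ?_
  filter_upwards [self_mem_nhdsWithin] with t ht
  rw [slope_def_field, slope_def_field, dz_eq_zero_of_x_eq_zero hs h0, h0, sub_zero, sub_zero,
    div_div_div_cancel_right₀ (sub_ne_zero.2 (x_ne t ht))]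
  rfl

theorem HasLawOn.x_ne_zero {L : CurvatureLaw} (h : S.HasLawOn L σ (interior S.J))
    (hσ : σ ^ 2 = 1) (hs : s ∈ S.J) : S.x s ≠ 0 := by
  intro h0
  obtain ⟨m, hm, x_ge⟩ := (h.profile hσ).exists_pos_le_x_of_rotCurv_le
    (σ * (S.ddz s / S.dx s) + 1)
  have convex : Convex ℝ S.J := S.interval.convex
  have : (𝓝[interior S.J] s).NeBot := by
    rw [← mem_closure_iff_nhdsWithin_neBot,
      convex.closure_interior_eq_closure_of_nonempty_interior S.interior_nonempty]
    exact subset_closure hs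
  have lim_x : Tendsto S.x (𝓝[interior S.J] s) (𝓝 0) := by
    rw [← h0]
    exact (hasDerivWithinAt_x hs).continuousWithinAt.mono_left
      (nhdsWithin_mono _ interior_subset)
  refine hm.not_ge (ge_of_tendsto lim_x ?_)
  filter_upwards [((tendsto_rotCurv_of_x_eq_zero hs h0).const_mul σ).eventually_lt_const
    (lt_add_one _), self_mem_nhdsWithin] with t ht htJ
  exact x_ge t htJ ((h.profile_rotCurv hσ htJ).trans_le ht.le)

theorem dz_eq_zero_or_hasLawOn (hα : W.α = 0) (hS : S.InClass W) :
    (∀ s ∈ S.J, S.dz s = 0) ∨ ∃ σ : ℝ, σ ^ 2 = 1 ∧ S.HasLawOn (W.law hα σ) σ S.J := by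
  by_cases h : ∃ a ∈ interior S.J, S.rotCurv a = 0
  · obtain ⟨a, ha, h0⟩ := h
    refine Or.inl fun s hs => ?_
    rcases (S.nonneg s hs).eq_or_lt with hx | hx
    · exact dz_eq_zero_of_x_eq_zero hs hx.symm
    · have := rotCurv_eq_zero hα hS ha (S.mem_interior s hs hx) h0
      rwa [rotCurv, div_eq_zero_iff, or_iff_left hx.ne'] at this
  · push Not at h
    obtain ⟨σ, hσ, rot_pos⟩ := exists_sign_mul_pos ordConnected_interior continuousOn_rotCurv h
    have curv : ∀ s ∈ interior S.J, W.b < S.rotCurv s ∧ S.profCurv s = W.f (S.rotCurv s) :=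
      fun s hs => (inClass_iff hα).1 hS s (interior_subset hs) (x_pos_of_mem_interior hs)
    have law : S.HasLawOn (W.law hα σ) σ (interior S.J) :=
      { isOpen := isOpen_interior
        ordConnected := ordConnected_interior
        nonempty := S.interior_nonempty
        subset_interior := Subset.rfl
        x_pos := fun s hs => x_pos_of_mem_interior hs
        mem_domain := fun s hs => (mul_mem_domain_law_iff hα hσ (rot_pos s hs)).2 (curv s hs).1
        profCurv_eq := fun s hs => by
          rw [(curv s hs).2, mul_f_eq_neg_rate hα hσ (rot_pos s hs)] }
    have interior_eq : interior S.J = S.J := interior_subset.antisymm fun s hs =>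
      S.mem_interior s hs ((S.nonneg s hs).lt_of_ne' (law.x_ne_zero hσ hs))
    exact Or.inr ⟨σ, hσ, interior_eq ▸ law⟩

end RotSurface

/-! ### Planes -/

namespace RotSurface

variable {S : RotSurface} {ε : ℝ}

theorem z_eq_of_dz_eq_zero (h : ∀ s ∈ S.J, S.dz s = 0) {a b : ℝ} (ha : a ∈ S.J) (hb : b ∈ S.J) :
    S.z a = S.z b :=
  eq_of_hasDerivWithinAt_zero S.interval (fun s hs => h s hs ▸ hasDerivWithinAt_z hs) ha hb

theorem exists_dx_eq_sign (h : ∀ s ∈ S.J, S.dz s = 0) :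
    ∃ ε : ℝ, ε ^ 2 = 1 ∧ ∀ s ∈ S.J, S.dx s = ε := by
  have dx_sq : ∀ s ∈ S.J, S.dx s ^ 2 = 1 := fun s hs => by
    rw [← dx_sq_add_dz_sq hs, h s hs, zero_pow two_ne_zero, add_zero]
  obtain ⟨ε, hε, sign⟩ := exists_sign_mul_pos S.interval (f := S.dx)
    (fun s hs => (hasDerivWithinAt_dx hs).continuousWithinAt)
    fun s hs => right_ne_zero_of_mul (sq (S.dx s) ▸ dx_sq s hs ▸ one_ne_zero)
  refine ⟨ε, hε, fun s hs => ?_⟩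
  rcases sq_eq_sq_iff_eq_or_eq_neg.1 ((dx_sq s hs).trans hε.symm) with h | h
  · exact h
  · have := sign s hs
    rw [h] at this
    linarith

theorem convex_setOf_nonneg_mul (ε : ℝ) : Convex ℝ {s | 0 ≤ ε * s} :=
  (convex_Ici 0).linear_preimage (LinearMap.mulLeft ℝ ε)

theorem mem_interior_setOf_nonneg_mul {s : ℝ} (hs : 0 < ε * s) : s ∈ interior {s | 0 ≤ ε * s} :=
  interior_maximal (fun _ (ht : 0 < ε * _) => ht.le)
    (isOpen_lt continuous_const (continuous_const_mul ε)) hs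

/-- The horizontal plane of height `h`, whose profile is the half-line traversed away from the axis
if `ε = 1` and towards it if `ε = -1`; the unit normal is `(0, 0, ε)`. -/
def horizontalPlane (hε : ε ^ 2 = 1) (h : ℝ) : RotSurface where
  J := {s | 0 ≤ ε * s}
  x s := ε * s
  z _ := h
  interval := (convex_setOf_nonneg_mul ε).ordConnected
  nontrivial := ⟨0, (mul_zero ε).ge, ε, by rw [mem_ofPred, ← sq, hε]; exact zero_le_one,
    fun h0 => by norm_num [← h0] at hε⟩
  contDiffOn_x := by fun_prop
  contDiffOn_z := contDiffOn_const
  nonneg _ hs := hs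
  arcLength s hs := by
    have uniqueDiff := uniqueDiffOn_convex (convex_setOf_nonneg_mul ε)
      ⟨ε, mem_interior_setOf_nonneg_mul (by rw [← sq, hε]; exact one_pos)⟩ s hs
    rw [(hasDerivAt_const_mul ε).hasDerivWithinAt.derivWithin uniqueDiff, derivWithin_fun_const,
      hε, Pi.zero_apply, zero_pow two_ne_zero, add_zero]
  mem_interior _ _ hs := mem_interior_setOf_nonneg_mul hs
  regular_on_axis _ _ _ := ⟨fun _ => h, contDiffAt_const, Eventually.of_forall fun _ => rfl⟩

theorem isPlane_horizontalPlane (hε : ε ^ 2 = 1) (h : ℝ) : (horizontalPlane hε h).IsPlane := by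
  refine ⟨h, Subset.antisymm ?_ fun p hp => ?_⟩
  · rintro _ ⟨q, -, rfl⟩
    simp [param, horizontalPlane]
  · let ζ : ℂ := ⟨p 0, p 1⟩
    have sign_mul (t : ℝ) : ε * (ε * t) = t := by rw [← mul_assoc, ← sq, hε, one_mul]
    refine ⟨(ε * ‖ζ‖, ζ.arg), ⟨(norm_nonneg ζ).trans (sign_mul _).ge, mem_univ _⟩, ?_⟩
    ext i
    fin_cases i
    · exact (congrArg (· * Real.cos ζ.arg) (sign_mul _)).trans (Complex.norm_mul_cos_arg ζ)
    · exact (congrArg (· * Real.sin ζ.arg) (sign_mul _)).trans (Complex.norm_mul_sin_arg ζ)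
    · exact hp.symm

theorem exists_isPlane_isOpenPiece (h : ∀ s ∈ S.J, S.dz s = 0) :
    ∃ T : RotSurface, T.IsPlane ∧ S.IsOpenPiece T := by
  obtain ⟨s₀, hs₀⟩ := S.nontrivial.nonempty
  obtain ⟨ε, hε, dx_eq⟩ := exists_dx_eq_sign h
  have x_eq : ∀ s ∈ S.J, S.x s = ε * (s + ε * (S.x s₀ - ε * s₀)) := fun s hs => by
    have : S.x s - ε * s = S.x s₀ - ε * s₀ :=
      eq_of_hasDerivWithinAt_zero S.interval (f := fun s => S.x s - ε * s) (fun t ht =>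
        ((hasDerivWithinAt_x ht).sub ((hasDerivWithinAt_id t _).const_mul ε)).congr_deriv
          (by rw [dx_eq t ht, mul_one, sub_self])) hs hs₀
    linear_combination this - (S.x s₀ - ε * s₀) * hε
  exact ⟨horizontalPlane hε (S.z s₀), isPlane_horizontalPlane hε _, ε * (S.x s₀ - ε * s₀),
    fun s hs => ⟨(S.nonneg s hs).trans (x_eq s hs).le, x_eq s hs, z_eq_of_dz_eq_zero h hs hs₀⟩⟩

end RotSurface

/-! ### Classification -/

theorem image_sign_mul {p : Set (ℝ × ℝ) → Prop} {A : Set (ℝ × ℝ)} {σ : ℝ} (hσ : σ ^ 2 = 1)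
    (hA : p A) (reflect : p ((fun q => (q.1, -q.2)) '' A)) :
    p ((fun q => (q.1, σ * q.2)) '' A) := by
  rcases sq_eq_one_iff.1 hσ with rfl | rfl
  · simpa only [one_mul, Prod.mk.eta, image_id'] using hA
  · simpa only [neg_one_mul] using reflect

namespace RotSurface

variable {W : EllipticClass} {T : RotSurface}

theorem InClass.isPinchedCatenoid (hT : T.InClass W) (hG : IsGraphTrace 0 T.trace) :
    T.IsPinchedCatenoid W := by
  obtain ⟨u, trace_eq, contDiffOn, convex, continuous, m, hm, slope_ge⟩ := hG
  refine ⟨hT, u, trace_eq, contDiffOn, convex, continuous, fun smooth => ?_⟩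
  have slope_small := (hasDerivAt_iff_isLittleO.1
    (hasDerivAt_comp_abs_zero (smooth.differentiableAt (by norm_num)))).def
    (half_pos hm)
  obtain ⟨r, small, hr⟩ := ((slope_small.filter_mono inf_le_left).and
    (Ioo_mem_nhdsGT (zero_lt_one' ℝ))).exists (f := 𝓝[>] 0)
  have large := slope_ge r hr.1 (by linarith [hr.2])
  simp only [abs_zero, sub_zero, smul_zero, Real.norm_eq_abs, abs_of_pos hr.1] at small large
  nlinarith [mul_pos hm hr.1]

theorem InClass.isSingularCatenoid (hT : T.InClass W) {d : ℝ} (hd : 0 < d)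
    (hG : IsGraphTrace d T.trace)
    (blowup : ∀ M : ℝ, ∃ r₀ > d, ∀ s ∈ T.J, T.x s < r₀ → M ≤ |T.profCurv s|) :
    T.IsSingularCatenoid W := by
  obtain ⟨u, trace_eq, contDiffOn, convex, continuous, -⟩ := hG
  refine ⟨hT, d, u, hd, trace_eq, contDiffOn, convex, continuous, tendsto_atTop.2 fun M => ?_⟩
  obtain ⟨r₀, hr₀, prof_ge⟩ := blowup (max M 1)
  rw [eventually_inf_principal]
  filter_upwards [preimage_mem_comap (Iio_mem_nhds hr₀)] with s hs hsJ
  obtain ⟨r, hr, hrs⟩ := trace_eq.subset (mem_image_of_mem _ hsJ)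
  obtain rfl : r = T.x s := congrArg Prod.fst hrs
  have x_pos := hd.trans hr
  rw [kappa1_sq_add_kappa2_sq (T.mem_interior s hsJ x_pos) x_pos, ← sq_abs (T.profCurv s)]
  nlinarith [prof_ge s hsJ hs, le_max_left M 1, le_max_right M 1, sq_nonneg (T.rotCurv s)]

end RotSurface

namespace CurvatureLaw

variable {L : CurvatureLaw}

namespace Profile

variable {P Q : L.Profile} {F : ℝ → ℝ} {C d s : ℝ}

theorem reverse_rotCurv : P.reverse.rotCurv s = P.rotCurv (-s) :=
  congrArg (· / P.x (-s)) (sine_neg (P.cos (-s)))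

theorem HasFirstIntegral.reverse (h : P.HasFirstIntegral F C) : P.reverse.HasFirstIntegral F C :=
  fun s hs => (h (-s) hs).trans (by rw [reverse_rotCurv])

theorem IsArcOf.of_reverse (h : P.reverse.IsArcOf Q) : P.IsArcOf Q.reverse := by
  obtain ⟨a, ha⟩ := h
  refine ⟨-a, fun s hs => ?_⟩
  obtain ⟨mem, x_eq, z_eq⟩ := ha (-s) (by rwa [← neg_neg s] at hs)
  simp only [reverse, neg_neg, mem_preimage, neg_add] at mem x_eq z_eq ⊢
  exact ⟨mem, x_eq, by rw [← z_eq, neg_neg]⟩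

/-- The profile curve is a graph over the exterior of the circle of radius `d`, which ends on the
axis if the law is unbounded, and otherwise on a circle where the curvature is infinite. -/
structure IsGraphOver (P : L.Profile) (d : ℝ) : Prop where
  isGraphTrace : IsGraphTrace d ((fun s => (P.x s, P.z s)) '' P.J)
  eq_zero : L.bound = ⊤ → d = 0
  pos : L.bound ≠ ⊤ → 0 < d
  exists_forall_le_rate : L.bound ≠ ⊤ → ∀ M : ℝ, ∃ r₀ > d, ∀ s ∈ P.J, P.x s < r₀ →
    M ≤ L.rate (P.rotCurv s)

theorem IsGraphOver.reverse (h : P.IsGraphOver d) : P.reverse.IsGraphOver d where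
  isGraphTrace := by
    have := h.isGraphTrace.reflect
    rw [image_image] at this
    convert this using 1
    change _ '' (Neg.neg ⁻¹' P.J) = _
    rw [Set.neg_preimage, ← Set.image_neg_eq_neg, image_image]
    simp only [Profile.reverse, neg_neg]
  eq_zero := h.eq_zero
  pos := h.pos
  exists_forall_le_rate hB M := by
    obtain ⟨r₀, hr₀, le_rate⟩ := h.exists_forall_le_rate hB M
    exact ⟨r₀, hr₀, fun s hs hlt => (le_rate (-s) hs hlt).trans_eq (by rw [reverse_rotCurv])⟩

end Profile

namespace Orbit.IsGraph

variable {O : L.Orbit} {P : L.Profile} (h : O.IsGraph)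
include h

theorem isGraphOver_profile (z₀ : ℝ) : (O.profile z₀).IsGraphOver O.innerRadius where
  isGraphTrace := O.trace_profile z₀ ▸ h.isGraphTrace z₀
  eq_zero := h.innerRadius_eq_zero
  pos := O.innerRadius_pos
  exists_forall_le_rate hB M := by
    obtain ⟨r₀, hr₀, le_rate⟩ := h.exists_forall_le_rate_curv hB M
    refine ⟨r₀, hr₀, forall_mem_image.2 fun c hc hlt => ?_⟩
    rw [O.profile_rotCurv_arc z₀ hc]
    exact le_rate c hc (O.profile_x_arc z₀ hc ▸ hlt)

theorem mem_D (hP : P.HasFirstIntegral O.F O.C) {s : ℝ} (hs : s ∈ P.J) (hcos : 0 < P.cos s) :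
    P.cos s ∈ O.D := by
  rw [h.D_eq]
  exact ⟨⟨hcos, (P.cos_mem s hs).2⟩, P.rotCurv s, P.mem_domain s hs,
    (eq_div_of_mul_eq O.C_pos.ne' ((mul_comm _ _).trans (hP.sine_cos_eq hs).symm))⟩

theorem exists_isGraphOver_isArcOf (hP : P.HasFirstIntegral O.F O.C) :
    ∃ Q : L.Profile, Q.IsGraphOver O.innerRadius ∧ P.IsArcOf Q := by
  have cos_ne_zero : ∀ s ∈ P.J, P.cos s ≠ 0 := fun s hs h0 => by
    have := h.C_mul_gFun_lt_one (P.rotCurv s) (P.mem_domain s hs)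
    rw [← hP.sine_cos_eq hs, h0] at this
    norm_num [sine] at this
  obtain ⟨ε, hε, sign⟩ := exists_sign_mul_pos P.ordConnected
    (HasDerivAt.continuousOn P.hasDerivAt_cos) cos_ne_zero
  rcases sq_eq_one_iff.1 hε with rfl | rfl
  · obtain ⟨z₀, arc⟩ := O.exists_isArcOf_profile hP fun s hs =>
      h.mem_D hP hs (one_mul (P.cos s) ▸ sign s hs)
    exact ⟨O.profile z₀, h.isGraphOver_profile z₀, arc⟩
  · obtain ⟨z₀, arc⟩ := O.exists_isArcOf_profile hP.reverse fun s hs =>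
      h.mem_D hP.reverse hs ((sign (-s) hs).trans_eq (neg_one_mul _))
    exact ⟨_, (h.isGraphOver_profile z₀).reverse, arc.of_reverse⟩

end Orbit.IsGraph

end CurvatureLaw

section

variable {W : EllipticClass} {hα : W.α = 0} {σ : ℝ} (hσ : σ ^ 2 = 1)

namespace CurvatureLaw.Profile.IsGraphOver

variable {P : (W.law hα σ).Profile} {d : ℝ}

theorem isGraphTrace_rotSurface (h : P.IsGraphOver d) :
    IsGraphTrace d (P.rotSurface hσ).trace := by
  rw [P.trace_rotSurface hσ]
  exact image_sign_mul hσ h.isGraphTrace h.isGraphTrace.reflect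

theorem isPinchedCatenoid (h : P.IsGraphOver d) (hB : (W.law hα σ).bound = ⊤) :
    (P.rotSurface hσ).IsPinchedCatenoid W :=
  ((P.hasLawOn_rotSurface hσ).inClass hσ).isPinchedCatenoid
    (h.eq_zero hB ▸ h.isGraphTrace_rotSurface hσ)

theorem isSingularCatenoid (h : P.IsGraphOver d) (hB : (W.law hα σ).bound ≠ ⊤) :
    (P.rotSurface hσ).IsSingularCatenoid W := by
  refine ((P.hasLawOn_rotSurface hσ).inClass hσ).isSingularCatenoid (h.pos hB)
    (h.isGraphTrace_rotSurface hσ) fun M => ?_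
  obtain ⟨r₀, hr₀, le_rate⟩ := h.exists_forall_le_rate hB M
  refine ⟨r₀, hr₀, fun s hs hlt => (le_rate s hs hlt).trans ?_⟩
  rw [P.rotSurface_profCurv hσ hs, abs_mul, abs_neg, abs_sign hσ, one_mul]
  exact le_abs_self _

end CurvatureLaw.Profile.IsGraphOver

theorem CurvatureLaw.Orbit.IsCatenoid.isCatenoidPlus_or_isCatenoidMinus
    {O : (W.law hα σ).Orbit} (h : O.IsCatenoid) (z₀ : ℝ) :
    ((O.profile z₀).rotSurface hσ).IsCatenoidPlus W (O.radius 0) ∨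
      ((O.profile z₀).rotSurface hσ).IsCatenoidMinus W (O.radius 0) := by
  have law := (O.profile z₀).hasLawOn_rotSurface hσ
  have special : ((O.profile z₀).rotSurface hσ).IsSpecialCatenoid W (O.radius 0) := by
    refine ⟨law.inClass hσ, h.image_arc, ?_⟩
    change IsCatenoidTrace _ _
    rw [CurvatureLaw.Profile.trace_rotSurface, O.trace_profile]
    exact image_sign_mul hσ (h.isCatenoidTrace z₀) (h.isCatenoidTrace z₀).reflect
  rcases sq_eq_one_iff.1 hσ with rfl | rfl
  · exact Or.inl ⟨special, fun s hs => (law.sign_mul_dz_pos hs).trans_eq (one_mul _)⟩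
  · exact Or.inr ⟨special, fun s hs => neg_pos.1
      ((law.sign_mul_dz_pos hs).trans_eq (neg_one_mul _))⟩

end

namespace RotSurface

variable {W : EllipticClass} {hα : W.α = 0} {S : RotSurface} {σ : ℝ}

theorem HasLawOn.isOpenPiece_catenoid (h : S.HasLawOn (W.law hα σ) σ S.J) (hσ : σ ^ 2 = 1) :
    (∃ (τ : ℝ) (T : RotSurface), 0 < τ ∧
        (T.IsCatenoidPlus W τ ∨ T.IsCatenoidMinus W τ) ∧ S.IsOpenPiece T) ∨
      (∃ T : RotSurface, T.IsPinchedCatenoid W ∧ S.IsOpenPiece T) ∨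
      (∃ T : RotSurface, T.IsSingularCatenoid W ∧ S.IsOpenPiece T) := by
  obtain ⟨F, hF⟩ := (W.law hα σ).exists_isPrimitive
  obtain ⟨C, hC, integral⟩ := (h.profile hσ).exists_hasFirstIntegral hF
  by_cases reaches_one : ∃ t ∈ (W.law hα σ).domain, C * gFun F t = 1
  · obtain ⟨t, ht, hCt⟩ := reaches_one
    obtain ⟨O, rfl, rfl, hO⟩ := hF.exists_isCatenoid hC ht hCt
    obtain ⟨z₀, arc⟩ := O.exists_isArcOf_profile integral
      fun s hs => hO.D_eq ▸ (h.profile hσ).cos_mem s hs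
    exact Or.inl ⟨O.radius 0, _, O.radius_pos 0, hO.isCatenoidPlus_or_isCatenoidMinus hσ z₀,
      arc.isOpenPiece hσ h⟩
  · have lt_one : ∀ t ∈ (W.law hα σ).domain, C * gFun F t < 1 := fun t ht => by
      by_contra! one_le
      obtain ⟨u, hu, hCu⟩ := hF.mem_image_gFun ht (inv_pos.2 hC)
        ((inv_le_iff_one_le_mul₀' hC).2 one_le)
      exact reaches_one ⟨u, hu, by rw [hCu, mul_inv_cancel₀ hC.ne']⟩
    obtain ⟨O, rfl, rfl, hO⟩ := hF.exists_isGraph hC lt_one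
    obtain ⟨Q, graph, arc⟩ := hO.exists_isGraphOver_isArcOf integral
    by_cases hB : (W.law hα σ).bound = ⊤
    · exact Or.inr (Or.inl ⟨_, graph.isPinchedCatenoid hσ hB, arc.isOpenPiece hσ h⟩)
    · exact Or.inr (Or.inr ⟨_, graph.isSingularCatenoid hσ hB, arc.isOpenPiece hσ h⟩)

end RotSurface

/-! ### Existence -/

namespace CurvatureLaw

variable {L : CurvatureLaw} {F : ℝ → ℝ}

theorem IsPrimitive.exists_isGraphOver (hF : L.IsPrimitive F)
    (hb : BddAbove (gFun F '' L.domain)) : ∃ (P : L.Profile) (d : ℝ), P.IsGraphOver d := by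
  obtain ⟨M, hM⟩ := hb
  obtain ⟨O, -, -, hO⟩ := hF.exists_isGraph (C := (|M| + 1)⁻¹) (by positivity) fun t ht => by
    rw [inv_mul_lt_iff₀ (by positivity), mul_one]
    linarith [hM (mem_image_of_mem _ ht), le_abs_self M]
  exact ⟨_, _, hO.isGraphOver_profile 0⟩

namespace Profile

variable {P : L.Profile} (hx : ∀ ε > 0, ∃ s ∈ P.J, P.x s < ε)
include hx

theorem bound_eq_top_of_forall_exists_x_lt : L.bound = ⊤ := by
  by_contra hB
  obtain ⟨m, hm, x_ge⟩ := P.exists_pos_le_x hB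
  obtain ⟨s, hs, x_lt⟩ := hx m hm
  exact x_lt.not_ge (x_ge s hs)

theorem bddAbove_image_gFun_of_forall_exists_x_lt (hF : L.IsPrimitive F) :
    BddAbove (gFun F '' L.domain) := by
  obtain ⟨C, hC, integral⟩ := P.exists_hasFirstIntegral hF
  refine ⟨1 / C, forall_mem_image.2 fun t ht => ?_⟩
  obtain ⟨s, hs, x_lt⟩ := hx (C * Real.exp (F t)) (mul_pos hC (Real.exp_pos _))
  rw [integral s hs, mul_lt_mul_iff_right₀ hC, Real.exp_lt_exp] at x_lt
  have t_lt := hF.antitoneOn.reflect_lt (P.mem_domain s hs) ht x_lt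
  calc gFun F t
      ≤ gFun F (P.rotCurv s) :=
        (hF.hasPosDerivOn_gFun.strictMonoOn ht (P.mem_domain s hs) t_lt).le
    _ ≤ 1 / C := by
        rw [le_div_iff₀' hC, ← integral.sine_cos_eq hs]
        exact sine_le_one _

end Profile

end CurvatureLaw

namespace RotSurface

variable {W : EllipticClass} {T : RotSurface} {d σ : ℝ}

theorem exists_eq_of_trace_eq {u : ℝ → ℝ} (trace_eq : T.trace = (fun r => (r, u r)) '' Ioi d)
    {r : ℝ} (hr : d < r) : ∃ s ∈ T.J, T.x s = r ∧ T.z s = u r := by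
  obtain ⟨s, hs, hsr⟩ := trace_eq.superset (mem_image_of_mem _ hr)
  exact ⟨s, hs, Prod.ext_iff.1 hsr⟩

theorem IsPinchedCatenoid.exists_dz_ne_zero (hT : T.IsPinchedCatenoid W) :
    ∃ s ∈ T.J, T.dz s ≠ 0 := by
  by_contra! flat
  obtain ⟨-, u, trace_eq, -, -, continuous, singular⟩ := hT
  have constant : ∀ r > 0, u r = u 1 := fun r hr => by
    obtain ⟨s, hs, -, z_s⟩ := exists_eq_of_trace_eq trace_eq hr
    obtain ⟨t, ht, -, z_t⟩ := exists_eq_of_trace_eq trace_eq one_pos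
    rw [← z_s, ← z_t, z_eq_of_dz_eq_zero flat hs ht]
  have u_zero : u 0 = u 1 := tendsto_nhds_unique (f := u) (l := 𝓝[>] 0) continuous
    (tendsto_const_nhds.congr' (eventually_mem_nhdsWithin.mono fun r hr => (constant r hr).symm))
  have radial_constant : (fun p : EuclideanSpace ℝ (Fin 2) => u ‖p‖) = fun _ => u 1 :=
    funext fun p => (norm_nonneg p).eq_or_lt.elim (fun h => h ▸ u_zero) (constant _)
  exact singular (radial_constant ▸ contDiffAt_const)

theorem IsPinchedCatenoid.exists_law (hα : W.α = 0) (hT : T.IsPinchedCatenoid W) :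
    ∃ σ : ℝ, σ ^ 2 = 1 ∧ (W.law hα σ).bound = ⊤ ∧
      ∀ F, (W.law hα σ).IsPrimitive F → BddAbove (gFun F '' (W.law hα σ).domain) := by
  obtain ⟨s, hs, dz_ne⟩ := hT.exists_dz_ne_zero
  obtain ⟨inClass, u, trace_eq, -⟩ := hT
  rcases dz_eq_zero_or_hasLawOn hα inClass with flat | ⟨σ, hσ, law⟩
  · exact absurd (flat s hs) dz_ne
  have reaches_axis : ∀ ε > 0, ∃ s ∈ (law.profile hσ).J, (law.profile hσ).x s < ε :=
    fun ε hε => by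
      obtain ⟨s, hs, x_s, -⟩ := exists_eq_of_trace_eq trace_eq (half_pos hε)
      exact ⟨s, hs, x_s.trans_lt (half_lt_self hε)⟩
  exact ⟨σ, hσ, CurvatureLaw.Profile.bound_eq_top_of_forall_exists_x_lt reaches_axis,
    fun F hF => CurvatureLaw.Profile.bddAbove_image_gFun_of_forall_exists_x_lt reaches_axis hF⟩

theorem IsSingularCatenoid.exists_lt_sq_add_sq (hT : T.IsSingularCatenoid W) :
    ∃ d > 0, ∀ M : ℝ, ∃ s ∈ T.J, d < T.x s ∧ M < T.profCurv s ^ 2 + T.rotCurv s ^ 2 := by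
  obtain ⟨-, d, u, hd, trace_eq, -, -, -, blowup⟩ := hT
  refine ⟨d, hd, fun M => ?_⟩
  have large := blowup.eventually_gt_atTop M
  rw [eventually_inf_principal, eventually_comap] at large
  obtain ⟨r, large_r, hr⟩ := ((large.filter_mono inf_le_left).and
    eventually_mem_nhdsWithin).exists (f := 𝓝[>] d)
  obtain ⟨s, hs, x_s, -⟩ := exists_eq_of_trace_eq trace_eq hr
  have d_lt : d < T.x s := x_s ▸ hr
  refine ⟨s, hs, d_lt, (large_r s x_s hs).trans_eq ?_⟩
  exact kappa1_sq_add_kappa2_sq (T.mem_interior s hs (hd.trans d_lt)) (hd.trans d_lt)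

theorem HasLawOn.sq_add_sq_le {L : CurvatureLaw} {J : Set ℝ} {s : ℝ} (h : T.HasLawOn L σ J)
    (hσ : σ ^ 2 = 1) (hB : L.bound = ⊤) (hd : 0 < d) (hs : s ∈ J) (hds : d ≤ T.x s) :
    T.profCurv s ^ 2 + T.rotCurv s ^ 2 ≤ L.rate (1 / d) ^ 2 + (1 / d) ^ 2 := by
  have mem := h.mem_domain s hs
  have rot_le : σ * T.rotCurv s ≤ 1 / d := by
    rw [← h.sine_dx_div_x hσ hs]
    exact div_le_div₀ zero_le_one (sine_le_one _) hd hds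
  have rate_le := L.monotoneOn_rate mem
    ⟨one_div_pos.2 hd, hB ▸ EReal.coe_lt_top (1 / d)⟩ rot_le
  calc T.profCurv s ^ 2 + T.rotCurv s ^ 2
      = (σ * T.profCurv s) ^ 2 + (σ * T.rotCurv s) ^ 2 := by
        rw [mul_pow, mul_pow, hσ, one_mul, one_mul]
    _ = L.rate (σ * T.rotCurv s) ^ 2 + (σ * T.rotCurv s) ^ 2 := by
        rw [h.profCurv_eq s hs, neg_sq]
    _ ≤ _ := add_le_add (pow_le_pow_left₀ (L.rate_pos _ mem).le rate_le 2)
        (pow_le_pow_left₀ mem.1.le rot_le 2)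

theorem IsSingularCatenoid.b_ne_bot (hα : W.α = 0) (hT : T.IsSingularCatenoid W) : W.b ≠ ⊥ := by
  intro hb
  obtain ⟨d, hd, large⟩ := hT.exists_lt_sq_add_sq
  rcases dz_eq_zero_or_hasLawOn hα hT.1 with flat | ⟨σ, hσ, law⟩
  · obtain ⟨s, hs, d_lt, curv_pos⟩ := large 0
    have rot_zero : T.rotCurv s = 0 := by rw [rotCurv, flat s hs, zero_div]
    rw [((inClass_iff hα).1 hT.1 s hs (hd.trans d_lt)).2, rot_zero, EllipticClass.f_zero hα]
      at curv_pos
    norm_num at curv_pos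
  · obtain ⟨s, hs, d_lt, curv_gt⟩ :=
      large ((W.law hα σ).rate (1 / d) ^ 2 + (1 / d) ^ 2)
    exact curv_gt.not_ge
      (law.sq_add_sq_le hσ ((EllipticClass.bound_law_eq_top_iff hα hσ).2 (Or.inr hb)) hd hs d_lt.le)

end RotSurface

namespace IsGFunction

variable {W : EllipticClass} {G : ℝ → ℝ}

theorem exists_isPrimitive_law_one (hG : IsGFunction W G) (hα : W.α = 0) :
    ∃ F, (W.law hα 1).IsPrimitive F ∧
      (FiniteAtTop G ↔ BddAbove (gFun F '' (W.law hα 1).domain)) :=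
  W.law_one hα ▸ hG.exists_isPrimitive_posLaw hα

theorem exists_isPrimitive_law_neg_one (hG : IsGFunction W G) (hα : W.α = 0) :
    ∃ F, (W.law hα (-1)).IsPrimitive F ∧
      (FiniteAtB W G ↔ BddAbove (gFun F '' (W.law hα (-1)).domain)) :=
  W.law_neg_one hα ▸ hG.exists_isPrimitive_negLaw hα

theorem exists_isPinchedCatenoid_iff (hG : IsGFunction W G) (hα : W.α = 0) :
    (∃ T : RotSurface, T.IsPinchedCatenoid W) ↔
      (FiniteAtTop G ∨ (W.b = ⊥ ∧ FiniteAtB W G)) := by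
  obtain ⟨F₁, hF₁, finite_top⟩ := hG.exists_isPrimitive_law_one hα
  obtain ⟨F₂, hF₂, finite_b⟩ := hG.exists_isPrimitive_law_neg_one hα
  rw [finite_top, finite_b]
  constructor
  · rintro ⟨T, hT⟩
    obtain ⟨σ, hσ, hB, bddAbove⟩ := hT.exists_law hα
    rcases sq_eq_one_iff.1 hσ with rfl | rfl
    · exact Or.inl (bddAbove F₁ hF₁)
    · exact Or.inr ⟨((EllipticClass.bound_law_eq_top_iff hα hσ).1 hB).resolve_left (by norm_num),
        bddAbove F₂ hF₂⟩
  · rintro (bddAbove | ⟨hb, bddAbove⟩)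
    · obtain ⟨P, d, hP⟩ := hF₁.exists_isGraphOver bddAbove
      exact ⟨_, hP.isPinchedCatenoid (by norm_num)
        ((EllipticClass.bound_law_eq_top_iff hα (by norm_num)).2 (Or.inl rfl))⟩
    · obtain ⟨P, d, hP⟩ := hF₂.exists_isGraphOver bddAbove
      exact ⟨_, hP.isPinchedCatenoid (by norm_num)
        ((EllipticClass.bound_law_eq_top_iff hα (by norm_num)).2 (Or.inr hb))⟩

theorem exists_isSingularCatenoid_iff (hG : IsGFunction W G) (hα : W.α = 0) :
    (∃ T : RotSurface, T.IsSingularCatenoid W) ↔ (W.b ≠ ⊥ ∧ FiniteAtB W G) := by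
  obtain ⟨F, hF, finite_b⟩ := hG.exists_isPrimitive_law_neg_one hα
  have bound_ne_top (hb : W.b ≠ ⊥) : (W.law hα (-1)).bound ≠ ⊤ := fun hB =>
    hb (((EllipticClass.bound_law_eq_top_iff hα (by norm_num)).1 hB).resolve_left (by norm_num))
  rw [finite_b]
  constructor
  · rintro ⟨T, hT⟩
    have hb := hT.b_ne_bot hα
    exact ⟨hb, hF.bddAbove_image_gFun (bound_ne_top hb)⟩
  · rintro ⟨hb, bddAbove⟩
    obtain ⟨P, d, hP⟩ := hF.exists_isGraphOver bddAbove
    exact ⟨_, hP.isSingularCatenoid (by norm_num) (bound_ne_top hb)⟩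

end IsGFunction

end

end Weingarten

theorem mainTheorem4 (W : Weingarten.EllipticClass) (hα : W.α = 0) :
    (∀ S : Weingarten.RotSurface, S.InClass W →
      (∃ T : Weingarten.RotSurface, T.IsPlane ∧ S.IsOpenPiece T) ∨
      (∃ (τ : ℝ) (T : Weingarten.RotSurface), 0 < τ ∧
        (T.IsCatenoidPlus W τ ∨ T.IsCatenoidMinus W τ) ∧ S.IsOpenPiece T) ∨
      (∃ T : Weingarten.RotSurface, T.IsPinchedCatenoid W ∧ S.IsOpenPiece T) ∨
      (∃ T : Weingarten.RotSurface, T.IsSingularCatenoid W ∧ S.IsOpenPiece T)) ∧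
    (∀ G : ℝ → ℝ, Weingarten.IsGFunction W G →
      ((∃ T : Weingarten.RotSurface, T.IsPinchedCatenoid W) ↔
        (Weingarten.FiniteAtTop G ∨ (W.b = ⊥ ∧ Weingarten.FiniteAtB W G))) ∧
      ((∃ T : Weingarten.RotSurface, T.IsSingularCatenoid W) ↔
        (W.b ≠ ⊥ ∧ Weingarten.FiniteAtB W G))) :=
  ⟨fun _ hS => (Weingarten.RotSurface.dz_eq_zero_or_hasLawOn hα hS).imp
      Weingarten.RotSurface.exists_isPlane_isOpenPiece
      fun ⟨_, hσ, law⟩ => law.isOpenPiece_catenoid hσ,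
    fun _ hG => ⟨hG.exists_isPinchedCatenoid_iff hα, hG.exists_isSingularCatenoid_iff hα⟩⟩
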